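/- **Setting.** One oscillator mode with $\hbar=1$, Hilbert space $L^2(\mathbb R)$ in the position picture, $\hat p=-i\,d/dq$, $\hat a=(\hat q+i\hat p)/\sqrt2$, $\hat n=\hat a^\dagger\hat a$ with Fock states $|n\rangle_f$, vacuum ${}_{\hat q}\langle q|0\rangle_f=\pi^{-1/4}e^{-q^2/2}$. Let $\hat X(r)=e^{-ir\hat p}$, $\hat Z(r)=e^{ir\hat q}$, $\hat V(r_1,r_2)=e^{-ir_1r_2/2}\hat Z(r_1)\hat X(r_2)$, $\hat S(\xi)=e^{i\xi(\hat q\hat p+\hat p\hat q)/2}$. Fix integers $d\ge 1$ and $0\le j<d$, put $\alpha_d=\sqrt{2\pi/d}$, and let $|j^{(\mathrm{ideal})}\rangle=\sqrt{\alpha_d d}\sum_{s\in\mathbb Z}|\alpha_d(ds+j)\rangle_{\hat q}$ (a tempered distribution, $|a\rangle_{\hat q}$ being the Dirac delta at $a$). For $\kappa,\Delta>0$, for real $\gamma,\delta$ with $0<\gamma\delta<2$, and for $\beta>0$ define $$|j^{(1)}_{\kappa,\Delta}\rangle=\frac1{\sqrt{N^{(1)}}}\sum_{s\in\mathbb Z}e^{-\frac12\kappa^2\alpha_d^2(ds+j)^2}\hat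 X(\alpha_d(ds+j))\hat S(-\ln\Delta)|0\rangle_f,$$ $$|j^{(2)}_{\gamma,\delta}\rangle=\frac1{\sqrt{N^{(2)}}}\iint\frac{dr_1dr_2}{2\pi\gamma\delta}\,e^{-\frac{r_1^2}{2\gamma^2}-\frac{r_2^2}{2\delta^2}}\hat V(r_1,r_2)|j^{(\mathrm{ideal})}\rangle,\qquad |j^{(3)}_{\beta}\rangle=\frac1{\sqrt{N^{(3)}}}e^{-\beta(\hat n+\frac12)}|j^{(\mathrm{ideal})}\rangle,$$ where $N^{(1)},N^{(2)},N^{(3)}>0$ (depending on $d$, $j$ and the parameters) normalize the states: the unnormalized expressions define nonzero vectors of $L^2(\mathbb R)$ and $N^{(i)}$ is the squared norm. The sum in the first state converges in $L^2$; the integral in the second is taken weakly against Schwartz functions; the operator in the third is $\sum_n e^{-\beta(n+1/2)}|n\rangle\langle n|_f$, with convergence in $L^2$. Let $G_\nu(x)=\frac1{\sqrt{2\pi\nu}}e^{-x^2/(2\nu)}$, $E_{\mu,\Gamma,a}(x)=e^{-x^2/(2\mu)}\sum_{s\in\mathbb Z}\delta(x-(s+a)\Gamma)$, $f*g(q)=\int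 f(y)g(q-y)\,dy$, $\vartheta\!\left[{a\atop b}\right]\!(z,\tau)=\sum_{s\in\mathbb Z}\exp[\pi i\tau(s+a)^2+2\pi i(z+b)(s+a)]$, $\lambda=1+\frac{\gamma^2\delta^2}4$ and $\rho=1-\frac{\gamma^2\delta^2}{2\lambda}$. **Proposition.** The position representations of these states are as follows (the first equality in each line being one of elements of $L^2(\mathbb R)$, i.e. for almost every $q$; the second holding for every $q\in\mathbb R$). (Approximation 1) $${}_{\hat q}\langle q|j^{(1)}_{\kappa,\Delta}\rangle=\Big(\tfrac{2\sqrt{\pi\Delta^2}}{N^{(1)}}\Big)^{\frac12}E_{\frac1{\kappa^2},\,\alpha_dd,\,\frac jd}*G_{\Delta^2}(q)=\Big(\tfrac{2\sqrt{\pi\Delta^2}}{\kappa^2dN^{(1)}}\Big)^{\frac12}G_{\frac{1+\kappa^2\Delta^2}{\kappa^2}}(q)\;\vartheta\!\left[{0\atop j/d}\right]\!\Big(-\tfrac{q}{\alpha_dd(1+\kappa^2\Delta^2)},\tfrac{i\Delta^2}{d(1+\kappa^2\Delta^2)}\Big).$$ (Approximation 2) $${}_{\hat q}\langle q|j^{(2)}_{\gamma,\delta}\rangle=\Big(\tfrac{\alpha_dd}{\lambda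 N^{(2)}}\Big)^{\frac12}E_{\frac{\lambda}{\gamma^2}\rho^2,\,\alpha_dd\rho,\,\frac jd}*G_{\frac{\delta^2}{\lambda}}(q)=\Big(\tfrac{\alpha_d\gamma^{-2}}{N^{(2)}}\Big)^{\frac12}G_{\frac{\lambda}{\gamma^2}}(q)\;\vartheta\!\left[{0\atop j/d}\right]\!\Big(-\tfrac{q\rho}{\alpha_dd},\tfrac{i\delta^2}{d\lambda}\Big).$$ (Approximation 3) $${}_{\hat q}\langle q|j^{(3)}_{\beta}\rangle=\Big(\tfrac{\alpha_dd}{\cosh\beta\,N^{(3)}}\Big)^{\frac12}E_{\frac1{\sinh\beta\cosh\beta},\,\frac{\alpha_dd}{\cosh\beta},\,\frac jd}*G_{\tanh\beta}(q)=\Big(\tfrac{\alpha_d}{\sinh\beta\,N^{(3)}}\Big)^{\frac12}G_{\frac1{\tanh\beta}}(q)\;\vartheta\!\left[{0\atop j/d}\right]\!\Big(-\tfrac{q}{\alpha_dd\cosh\beta},\tfrac{i\tanh\beta}{d}\Big).$$ -/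

import Mathlib

open MeasureTheory SchwartzMap
open scoped SchwartzMap ContDiff

namespace GKP

noncomputable section

/-! ### Operators of one oscillator mode in the position picture (`ħ = 1`)

Test states are Schwartz functions of the position variable; `𝓢'(ℝ, ℂ)` holds the
non-normalizable kets and `L2` the normalizable ones. -/

/-- The Hilbert space `L²(ℝ)` of one mode, in the position picture: the position representation
`⟨q|ψ⟩` of `ψ : L2` is the function `ψ` itself (almost everywhere defined). -/
abbrev L2 : Type := Lp ℂ 2 (volume : Measure ℝ)

/-- The position operator `q̂`, multiplication by the variable. -/
def opQ : 𝓢(ℝ, ℂ) →L[ℂ] 𝓢(ℝ, ℂ) := SchwartzMap.smulLeftCLM ℂ (fun x : ℝ => (x : ℂ))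

/-- The momentum operator `p̂ = -i d/dx`. -/
def opP : 𝓢(ℝ, ℂ) →L[ℂ] 𝓢(ℝ, ℂ) := (-Complex.I) • SchwartzMap.derivCLM ℂ ℂ

/-- The annihilation operator `â = (q̂ + i p̂)/√2`. -/
def annihilation : 𝓢(ℝ, ℂ) →L[ℂ] 𝓢(ℝ, ℂ) :=
  (((1 / √2 : ℝ)) : ℂ) • (opQ + Complex.I • opP)

/-- The creation operator `â† = (q̂ - i p̂)/√2`. -/
def creation : 𝓢(ℝ, ℂ) →L[ℂ] 𝓢(ℝ, ℂ) :=
  (((1 / √2 : ℝ)) : ℂ) • (opQ - Complex.I • opP)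

/-- The number operator `n̂ = â† â`. -/
def numberOp : 𝓢(ℝ, ℂ) →L[ℂ] 𝓢(ℝ, ℂ) := creation ∘L annihilation

/-- The displacement `X̂(r) = exp(-i r p̂)`, that is `f ↦ f(· - r)`. -/
def opX (r : ℝ) : 𝓢(ℝ, ℂ) →L[ℂ] 𝓢(ℝ, ℂ) := SchwartzMap.compSubConstCLM ℂ r

/-- The displacement `Ẑ(r) = exp(i r q̂)`, multiplication by `exp(i r x)`. -/
def opZ (r : ℝ) : 𝓢(ℝ, ℂ) →L[ℂ] 𝓢(ℝ, ℂ) :=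
  SchwartzMap.smulLeftCLM ℂ (fun x : ℝ => Complex.exp (Complex.I * (r : ℂ) * (x : ℂ)))

/-- The dilation `x ↦ exp(ξ) x` of the line. -/
def dilation (ξ : ℝ) : ℝ ≃L[ℝ] ℝ :=
  ContinuousLinearEquiv.smulLeft (Units.mk0 (Real.exp ξ) (Real.exp_pos ξ).ne')

/-- The squeezing operator `Ŝ(ξ) = exp(i ξ (q̂ p̂ + p̂ q̂)/2)`, that is
`f ↦ exp(ξ/2) f(exp(ξ) ·)`. -/
def opS (ξ : ℝ) : 𝓢(ℝ, ℂ) →L[ℂ] 𝓢(ℝ, ℂ) :=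
  ((Real.exp (ξ / 2) : ℝ) : ℂ) • SchwartzMap.compCLMOfContinuousLinearEquiv ℂ (dilation ξ)

theorem temperate_expI (r : ℝ) : Function.HasTemperateGrowth
    (fun x : ℝ => Complex.exp (Complex.I * (r : ℂ) * (x : ℂ))) := by
  have hit : ∀ n : ℕ, iteratedDeriv n
      (fun x : ℝ => Complex.exp (Complex.I * (r : ℂ) * (x : ℂ))) =
      fun x : ℝ => (Complex.I * (r : ℂ)) ^ n * Complex.exp (Complex.I * (r : ℂ) * (x : ℂ)) := by
    intro n
    induction n with
    | zero => simp
    | succ n ih =>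
      rw [iteratedDeriv_succ, ih]
      funext x
      have h1 : HasDerivAt (fun x : ℝ => Complex.I * (r : ℂ) * (x : ℂ))
          (Complex.I * (r : ℂ)) x := by
        simpa using (Complex.ofRealCLM.hasDerivAt (x := x)).const_mul (Complex.I * (r : ℂ))
      rw [((h1.cexp).const_mul ((Complex.I * (r : ℂ)) ^ n)).deriv]
      ring
  have hc : ContDiff ℝ ∞ (fun x : ℝ => Complex.exp (Complex.I * (r : ℂ) * (x : ℂ))) :=
    (contDiff_const.mul Complex.ofRealCLM.contDiff).cexp
  refine ⟨hc, fun n => ⟨0, |r| ^ n, fun x => ?_⟩⟩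
  rw [norm_iteratedFDeriv_eq_norm_iteratedDeriv, hit n]
  have : Complex.I * (r : ℂ) * (x : ℂ) = ((r * x : ℝ) : ℂ) * Complex.I := by push_cast; ring
  simp [this, Complex.norm_exp_ofReal_mul_I, -Complex.ofReal_mul]

theorem opQ_apply (f : 𝓢(ℝ, ℂ)) (x : ℝ) : opQ f x = (x : ℂ) * f x := by
  have h : Function.HasTemperateGrowth (fun x : ℝ => (x : ℂ)) :=
    Complex.ofRealCLM.hasTemperateGrowth
  simp [opQ, SchwartzMap.smulLeftCLM_apply_apply h]

theorem opP_apply (f : 𝓢(ℝ, ℂ)) (x : ℝ) : opP f x = -Complex.I * deriv f x := by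
  simp [opP]

theorem opX_apply (r : ℝ) (f : 𝓢(ℝ, ℂ)) (x : ℝ) : opX r f x = f (x - r) := rfl

theorem opZ_apply (r : ℝ) (f : 𝓢(ℝ, ℂ)) (x : ℝ) :
    opZ r f x = Complex.exp (Complex.I * (r : ℂ) * (x : ℂ)) * f x := by
  simp [opZ, SchwartzMap.smulLeftCLM_apply_apply (temperate_expI r)]

theorem opS_apply (ξ : ℝ) (f : 𝓢(ℝ, ℂ)) (x : ℝ) :
    opS ξ f x = ((Real.exp (ξ / 2) : ℝ) : ℂ) * f (Real.exp ξ * x) := by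
  simp [opS, dilation]

/-- `X̂(0) = 1` and `d/dr X̂(r) = -i p̂ X̂(r)`. -/
theorem opX_generator (f : 𝓢(ℝ, ℂ)) (x r : ℝ) : opX 0 f = f ∧
    HasDerivAt (fun t : ℝ => opX t f x) (-Complex.I * opP (opX r f) x) r := by
  refine ⟨by ext y; simp [opX_apply], ?_⟩
  have h := (f.hasDerivAt (x - r)).scomp r ((hasDerivAt_id r).const_sub x)
  have h2 : deriv (opX r f) x = deriv f (x - r) := by
    have : (opX r f : ℝ → ℂ) = fun y => f (y - r) := by funext y; rfl
    rw [this, deriv_comp_sub_const]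
  rw [opP_apply, h2]
  refine h.congr_deriv ?_
  rw [← mul_assoc]
  simp

/-- `Ẑ(0) = 1` and `d/dr Ẑ(r) = i q̂ Ẑ(r)`. -/
theorem opZ_generator (f : 𝓢(ℝ, ℂ)) (x r : ℝ) : opZ 0 f = f ∧
    HasDerivAt (fun t : ℝ => opZ t f x) (Complex.I * opQ (opZ r f) x) r := by
  refine ⟨by ext y; simp [opZ_apply], ?_⟩
  simp only [opZ_apply, opQ_apply]
  have h1 : HasDerivAt (fun t : ℝ => Complex.I * (t : ℂ) * (x : ℂ))
      (Complex.I * (x : ℂ)) r := by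
    simpa using ((Complex.ofRealCLM.hasDerivAt (x := r)).const_mul Complex.I).mul_const (x : ℂ)
  exact ((h1.cexp).mul_const (f x)).congr_deriv (by ring)

/-- `Ŝ(0) = 1` and `d/dξ Ŝ(ξ) = i ((q̂ p̂ + p̂ q̂)/2) Ŝ(ξ)`. -/
theorem opS_generator (f : 𝓢(ℝ, ℂ)) (x ξ : ℝ) : opS 0 f = f ∧
    HasDerivAt (fun t : ℝ => opS t f x)
      (Complex.I * ((opQ (opP (opS ξ f)) x + opP (opQ (opS ξ f)) x) / 2)) ξ := by
  refine ⟨by ext y; simp [opS_apply], ?_⟩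
  have hg := (opS ξ f).hasDerivAt x
  have hQ : (opQ (opS ξ f) : ℝ → ℂ) = fun y : ℝ => (y : ℂ) * opS ξ f y := by
    funext y; exact opQ_apply _ _
  have hd : deriv (opQ (opS ξ f)) x = opS ξ f x + (x : ℂ) * deriv (opS ξ f) x := by
    rw [hQ]
    have := ((Complex.ofRealCLM.hasDerivAt (x := x)).mul hg).deriv
    simp only [Complex.ofRealCLM_apply, Complex.ofReal_one, one_mul] at this
    exact this
  have hg2 : deriv (opS ξ f) x =
      ((Real.exp (ξ / 2) : ℝ) : ℂ) * (Real.exp ξ * deriv f (Real.exp ξ * x)) := by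
    have h1 : (opS ξ f : ℝ → ℂ) =
        fun y => ((Real.exp (ξ / 2) : ℝ) : ℂ) * f (Real.exp ξ * y) := by
      funext y; exact opS_apply _ _ _
    have h2 := ((f.hasDerivAt (Real.exp ξ * x)).scomp x
      ((hasDerivAt_id x).const_mul (Real.exp ξ))).const_mul ((Real.exp (ξ / 2) : ℝ) : ℂ)
    rw [h1]
    have h3 := h2.deriv
    simpa [Function.comp_def] using h3
  rw [opQ_apply, opP_apply, opP_apply, hd, hg2]
  simp only [opS_apply]
  have e1 : HasDerivAt (fun t : ℝ => ((Real.exp (t / 2) : ℝ) : ℂ))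
      (((Real.exp (ξ / 2) * (1 / 2) : ℝ)) : ℂ) ξ :=
    (((hasDerivAt_id ξ).div_const 2).exp).ofReal_comp
  have e2 := (f.hasDerivAt (Real.exp ξ * x)).scomp ξ ((Real.hasDerivAt_exp ξ).mul_const x)
  refine (e1.mul e2).congr_deriv ?_
  simp only [Function.comp_def, Complex.real_smul]
  push_cast
  linear_combination (Complex.exp (ξ / 2) * f (Real.exp ξ * x) / 2
    + Complex.exp (ξ / 2) * (x * (Complex.exp ξ * deriv f (Real.exp ξ * x)))) * Complex.I_sq

/-! ### Fock states -/

theorem gaussian_decay (k n : ℕ) : ∃ C : ℝ, ∀ x : ℝ,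
    ‖x‖ ^ k * ‖iteratedFDeriv ℝ n (fun y : ℝ => Real.exp (-(y ^ 2 / 2))) x‖ ≤ C := by
  have hpoly : ∀ p : Polynomial ℝ, ∃ C : ℝ, ∀ x : ℝ, |p.eval x * Real.exp (-(x ^ 2 / 2))| ≤ C := by
    intro p
    induction p using Polynomial.induction_on' with
    | add p q hp hq =>
      obtain ⟨C, hC⟩ := hp
      obtain ⟨D, hD⟩ := hq
      refine ⟨C + D, fun x => ?_⟩
      rw [Polynomial.eval_add, add_mul]
      exact (abs_add_le _ _).trans (add_le_add (hC x) (hD x))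
    | monomial m a =>
      refine ⟨|a| * (2 ^ m * (m.factorial : ℝ) + 1), fun x => ?_⟩
      rw [Polynomial.eval_monomial, abs_mul, abs_mul, mul_assoc, abs_of_pos (Real.exp_pos _)]
      refine mul_le_mul_of_nonneg_left ?_ (abs_nonneg a)
      rw [Real.exp_neg, ← div_eq_mul_inv, div_le_iff₀ (Real.exp_pos _)]
      have h1 := Real.pow_div_factorial_le_exp (x ^ 2 / 2) (by positivity) m
      rw [div_le_iff₀ (by positivity), div_pow, div_le_iff₀ (by positivity)] at h1
      have h2 : 1 ≤ Real.exp (x ^ 2 / 2) := Real.one_le_exp (by positivity)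
      have h3 : |x ^ m| ≤ 1 + (x ^ 2) ^ m := by
        have : (x ^ 2) ^ m = |x ^ m| ^ 2 := by rw [sq_abs]; ring
        rw [this]; nlinarith [sq_nonneg (|x ^ m| - 1), abs_nonneg (x ^ m)]
      nlinarith
  obtain ⟨C, hC⟩ := hpoly (Polynomial.X ^ k * (Polynomial.hermite n).map (Int.castRingHom ℝ))
  refine ⟨C, fun x => ?_⟩
  rw [norm_iteratedFDeriv_eq_norm_iteratedDeriv, iteratedDeriv_eq_iterate,
    Polynomial.deriv_gaussian_eq_hermite_mul_gaussian]
  have h := hC x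
  rw [Polynomial.eval_mul, Polynomial.eval_pow, Polynomial.eval_X, Polynomial.eval_map] at h
  rw [Polynomial.aeval_def]
  simpa [abs_mul, mul_assoc] using h

/-- The function `exp(-x²/2)` as a Schwartz function. -/
def gaussianS : 𝓢(ℝ, ℝ) where
  toFun := fun y : ℝ => Real.exp (-(y ^ 2 / 2))
  smooth' := by fun_prop
  decay' := gaussian_decay

/-- The vacuum state `|0⟩_f`, with `⟨x|0⟩_f = π^(-1/4) exp(-x²/2)`. -/
def vacuum : 𝓢(ℝ, ℂ) :=
  ((Real.pi ^ (-(1 / 4 : ℝ)) : ℝ) : ℂ) • SchwartzMap.postcompCLM Complex.ofRealCLM gaussianS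

theorem vacuum_apply (x : ℝ) :
    vacuum x = ((Real.pi ^ (-(1 / 4 : ℝ)) * Real.exp (-(x ^ 2 / 2)) : ℝ) : ℂ) := by
  push_cast
  simp [vacuum, gaussianS]
  left
  change ((Real.exp (-(x ^ 2 / 2)) : ℝ) : ℂ) = _
  push_cast
  rfl

/-- The Fock state `|n⟩_f = (â†)ⁿ |0⟩_f / √(n!)`. -/
def fock (n : ℕ) : 𝓢(ℝ, ℂ) :=
  ((1 / √(n.factorial : ℝ) : ℝ) : ℂ) • (creation ^ n) vacuum

theorem annihilation_apply (f : 𝓢(ℝ, ℂ)) (x : ℝ) :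
    annihilation f x = ((1 / √2 : ℝ) : ℂ) * ((x : ℂ) * f x + deriv f x) := by
  simp only [annihilation, smul_apply, add_apply, opQ_apply, opP_apply, smul_eq_mul]
  linear_combination (-((1 / √2 : ℝ) : ℂ) * deriv f x) * Complex.I_sq

theorem creation_apply (f : 𝓢(ℝ, ℂ)) (x : ℝ) :
    creation f x = ((1 / √2 : ℝ) : ℂ) * ((x : ℂ) * f x - deriv f x) := by
  simp only [creation, smul_apply, sub_apply, opQ_apply, opP_apply, smul_eq_mul]
  linear_combination (((1 / √2 : ℝ) : ℂ) * deriv f x) * Complex.I_sq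

theorem annihilation_vacuum : annihilation vacuum = 0 := by
  ext x
  have hv : (vacuum : ℝ → ℂ) =
      fun y : ℝ => ((Real.pi ^ (-(1 / 4 : ℝ)) * Real.exp (-(y ^ 2 / 2)) : ℝ) : ℂ) := by
    funext y; exact vacuum_apply y
  have hd : HasDerivAt (fun y : ℝ => Real.pi ^ (-(1 / 4 : ℝ)) * Real.exp (-(y ^ 2 / 2)))
      (Real.pi ^ (-(1 / 4 : ℝ)) * (Real.exp (-(x ^ 2 / 2)) * (-x))) x := by
    refine HasDerivAt.const_mul _ (HasDerivAt.exp ?_)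
    refine (((hasDerivAt_pow 2 x).div_const 2).neg).congr_deriv ?_
    norm_num
  rw [annihilation_apply, hv, hd.ofReal_comp.deriv]
  push_cast
  simp
  ring

theorem annihilation_creation (f : 𝓢(ℝ, ℂ)) :
    annihilation (creation f) = creation (annihilation f) + f := by
  ext x
  have hc : deriv (creation f) x =
      ((1 / √2 : ℝ) : ℂ) * (f x + x * deriv f x - deriv (deriv f) x) := by
    have h1 : (creation f : ℝ → ℂ) =
        fun y : ℝ => ((1 / √2 : ℝ) : ℂ) * ((y : ℂ) * f y - deriv f y) := by
      funext y; exact creation_apply f y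
    have h2 := ((((Complex.ofRealCLM.hasDerivAt (x := x)).mul (f.hasDerivAt x)).sub
      ((SchwartzMap.derivCLM ℂ ℂ f).hasDerivAt x)).const_mul ((1 / √2 : ℝ) : ℂ)).deriv
    simp only [Complex.ofRealCLM_apply, Complex.ofReal_one, one_mul] at h2
    rw [h1]
    exact h2
  have ha : deriv (annihilation f) x =
      ((1 / √2 : ℝ) : ℂ) * (f x + x * deriv f x + deriv (deriv f) x) := by
    have h1 : (annihilation f : ℝ → ℂ) =
        fun y : ℝ => ((1 / √2 : ℝ) : ℂ) * ((y : ℂ) * f y + deriv f y) := by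
      funext y; exact annihilation_apply f y
    have h2 := ((((Complex.ofRealCLM.hasDerivAt (x := x)).mul (f.hasDerivAt x)).add
      ((SchwartzMap.derivCLM ℂ ℂ f).hasDerivAt x)).const_mul ((1 / √2 : ℝ) : ℂ)).deriv
    simp only [Complex.ofRealCLM_apply, Complex.ofReal_one, one_mul] at h2
    rw [h1]
    exact h2
  have hs : ((1 / √2 : ℝ) : ℂ) * ((1 / √2 : ℝ) : ℂ) = 1 / 2 := by
    rw [← Complex.ofReal_mul, div_mul_div_comm, Real.mul_self_sqrt (by norm_num)]
    norm_num
  rw [add_apply, annihilation_apply, creation_apply, creation_apply, annihilation_apply, hc, ha]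
  linear_combination (2 * f x) * hs

/-- The Fock states are the eigenstates of the number operator: `n̂ |n⟩_f = n |n⟩_f`. -/
theorem numberOp_fock (n : ℕ) : numberOp (fock n) = (n : ℂ) • fock n := by
  have key : ∀ m : ℕ, numberOp ((creation ^ m) vacuum) = (m : ℂ) • (creation ^ m) vacuum := by
    intro m
    induction m with
    | zero => simp [numberOp, annihilation_vacuum]
    | succ m ih =>
      have h1 : (creation ^ (m + 1)) vacuum = creation ((creation ^ m) vacuum) := by
        rw [pow_succ']; rfl
      have h2 : creation (annihilation ((creation ^ m) vacuum)) =
          (m : ℂ) • (creation ^ m) vacuum := ih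
      rw [h1]
      change creation (annihilation (creation ((creation ^ m) vacuum))) = _
      rw [annihilation_creation, h2, map_add, map_smul]
      push_cast
      rw [add_smul, one_smul]
  rw [fock, map_smul, key, smul_comm]

/-! ### Non-normalizable kets -/

/-- The generalized position eigenket `|a⟩_q`, with `⟨x|a⟩ = δ(x - a)`. -/
def posKet (a : ℝ) : 𝓢'(ℝ, ℂ) := TemperedDistribution.delta a

/-- The displacement `X̂(r)` on generalized kets: `T ↦ T(· - r)`, so that
`(X̂(r) T)(φ) = T(φ(· + r))`. -/
def distX (r : ℝ) : 𝓢'(ℝ, ℂ) →L[ℂ] 𝓢'(ℝ, ℂ) := PointwiseConvergenceCLM.precomp ℂ (opX (-r))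

/-- The displacement `Ẑ(r)` on generalized kets: multiplication by `exp(i r x)`. -/
def distZ (r : ℝ) : 𝓢'(ℝ, ℂ) →L[ℂ] 𝓢'(ℝ, ℂ) := PointwiseConvergenceCLM.precomp ℂ (opZ r)

/-- The Weyl-Heisenberg displacement `V̂(r) = exp(-i r_p r_q/2) Ẑ(r_p) X̂(r_q)`,
`r = (r_p, r_q)`, on generalized kets. -/
def distV (r : ℝ × ℝ) (T : 𝓢'(ℝ, ℂ)) : 𝓢'(ℝ, ℂ) :=
  Complex.exp (-Complex.I * (r.1 : ℂ) * (r.2 : ℂ) / 2) • distZ r.1 (distX r.2 T)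

/-- `X̂(r) |a⟩_q = |a + r⟩_q`. -/
theorem distX_posKet (r a : ℝ) : distX r (posKet a) = posKet (a + r) := by
  ext φ
  change φ (a - -r) = φ (a + r)
  rw [sub_neg_eq_add]

/-- `Ẑ(r) |a⟩_q = exp(i r a) |a⟩_q`. -/
theorem distZ_posKet (r a : ℝ) :
    distZ r (posKet a) = Complex.exp (Complex.I * (r : ℂ) * (a : ℂ)) • posKet a := by
  ext φ
  exact opZ_apply r φ a

/-- On kets given by Schwartz functions, `distX` and `distZ` are `opX` and `opZ`. -/
theorem dist_coe (r : ℝ) (f : 𝓢(ℝ, ℂ)) :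
    distX r (f : 𝓢'(ℝ, ℂ)) = (opX r f : 𝓢(ℝ, ℂ)) ∧
    distZ r (f : 𝓢'(ℝ, ℂ)) = (opZ r f : 𝓢(ℝ, ℂ)) := by
  constructor
  · ext φ
    change (f : 𝓢'(ℝ, ℂ)) (opX (-r) φ) = _
    rw [SchwartzMap.coe_apply, SchwartzMap.coe_apply,
      ← integral_sub_right_eq_self (fun x => opX (-r) φ x • f x) r]
    simp [opX_apply]
  · ext φ
    change (f : 𝓢'(ℝ, ℂ)) (opZ r φ) = _
    rw [SchwartzMap.coe_apply, SchwartzMap.coe_apply]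
    congr 1
    funext x
    simp only [opZ_apply, smul_eq_mul]
    ring

/-- The complex conjugate of a Schwartz function. -/
def conjS (φ : 𝓢(ℝ, ℂ)) : 𝓢(ℝ, ℂ) :=
  SchwartzMap.postcompCLM (𝕜 := ℝ) (Complex.conjCLE : ℂ →L[ℝ] ℂ) φ

/-- The bracket `⟨φ|T⟩` of a Schwartz state with a generalized ket. -/
def bracket (φ : 𝓢(ℝ, ℂ)) (T : 𝓢'(ℝ, ℂ)) : ℂ := T (conjS φ)

/-- `Ψ ∈ L²` is the integral `∫ F(r) dr` of the generalized kets `F(r)`, tested on every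
Schwartz function. -/
def HasKetIntegral (F : ℝ × ℝ → 𝓢'(ℝ, ℂ)) (Ψ : L2) : Prop :=
  ∀ φ : 𝓢(ℝ, ℂ), Integrable (fun r => F r φ) ∧
    ∫ r, F r φ = (Ψ : 𝓢'(ℝ, ℂ)) φ

open Classical in
/-- The integral `∫ F(r) dr` as an element of `L²` (`0` if there is none). -/
def ketIntegral (F : ℝ × ℝ → 𝓢'(ℝ, ℂ)) : L2 :=
  if h : ∃ Ψ : L2, HasKetIntegral F Ψ then h.choose else 0

theorem HasKetIntegral.unique {F : ℝ × ℝ → 𝓢'(ℝ, ℂ)} {Ψ Φ : L2}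
    (h : HasKetIntegral F Ψ) (h' : HasKetIntegral F Φ) : Ψ = Φ := by
  have hk := Lp.ker_toTemperedDistributionCLM_eq_bot (E := ℝ) (F := ℂ)
    (μ := (volume : Measure ℝ)) (p := 2)
  refine (LinearMap.ker_eq_bot.1 hk) ?_
  ext φ
  exact ((h φ).2).symm.trans (h' φ).2

theorem HasKetIntegral.ketIntegral_eq {F : ℝ × ℝ → 𝓢'(ℝ, ℂ)} {Ψ : L2}
    (h : HasKetIntegral F Ψ) : ketIntegral F = Ψ := by
  have he : ∃ Ψ : L2, HasKetIntegral F Ψ := ⟨Ψ, h⟩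
  rw [ketIntegral, dif_pos he]
  exact he.choose_spec.unique h

theorem summable_weight {Γ : ℝ} (hΓ : Γ ≠ 0) (c : ℝ) :
    Summable (fun s : ℤ => 1 / (1 + (Γ * s + c) ^ 2)) := by
  have h := (Real.summable_one_div_int_add_rpow (c / Γ) 2).2 (by norm_num)
  have h2 := (h.mul_left (1 / Γ ^ 2)).add
    (summable_of_ne_finset_zero (f := fun s : ℤ => if (s : ℝ) + c / Γ = 0 then (1 : ℝ) else 0)
      (s := {⌊-(c / Γ)⌋}) (fun b hb => if_neg (fun h0 => hb (by
        have hb2 : (b : ℝ) = -(c / Γ) := by linarith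
        rw [Finset.mem_singleton, ← hb2, Int.floor_intCast]))))
  refine Summable.of_nonneg_of_le (fun s => by positivity) (fun s => ?_) h2
  have e : Γ * s + c = Γ * (s + c / Γ) := by field_simp
  have hr : |(s : ℝ) + c / Γ| ^ (2 : ℝ) = ((s : ℝ) + c / Γ) ^ 2 := by
    rw [Real.rpow_two, sq_abs]
  rw [e, hr]
  by_cases h0 : (s : ℝ) + c / Γ = 0
  · simp [h0]
  · rw [if_neg h0, add_zero, div_mul_div_comm, one_mul, mul_pow]
    have : 0 < Γ ^ 2 * ((s : ℝ) + c / Γ) ^ 2 := by positivity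
    exact one_div_le_one_div_of_le this (by linarith)

theorem schwartz_weight (f : 𝓢(ℝ, ℂ)) (x : ℝ) :
    ‖f x‖ ≤ (4 * ((Finset.Iic (2, 0)).sup (schwartzSeminormFamily ℂ ℝ ℂ)) f) *
      (1 / (1 + x ^ 2)) := by
  have h := SchwartzMap.one_add_le_sup_seminorm_apply (𝕜 := ℂ) (m := (2, 0)) (k := 2) (n := 0)
    le_rfl le_rfl f x
  rw [norm_iteratedFDeriv_zero, Real.norm_eq_abs] at h
  rw [mul_one_div, le_div_iff₀ (by positivity)]
  have h2 : 1 + x ^ 2 ≤ (1 + |x|) ^ 2 := by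
    nlinarith [abs_nonneg x, sq_abs x]
  calc ‖f x‖ * (1 + x ^ 2) ≤ ‖f x‖ * (1 + |x|) ^ 2 := by gcongr
    _ = (1 + |x|) ^ 2 * ‖f x‖ := mul_comm _ _
    _ ≤ _ := h
    _ = _ := by norm_num; rfl

/-- A Dirac comb converges in the space of tempered distributions. -/
theorem summable_posKet {Γ : ℝ} (hΓ : Γ ≠ 0) (c : ℝ) :
    Summable (fun s : ℤ => posKet (Γ * s + c)) := by
  have hw := summable_weight hΓ c
  have hsum : ∀ f : 𝓢(ℝ, ℂ), Summable (fun s : ℤ => f (Γ * s + c)) := fun f =>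
    Summable.of_norm_bounded (hw.mul_left _) (fun s => schwartz_weight f _)
  let A : 𝓢(ℝ, ℂ) →L[ℂ] ℂ :=
    SchwartzMap.mkCLMtoNormedSpace (𝕜 := ℂ) (σ := RingHom.id ℂ)
      (fun f => ∑' s : ℤ, f (Γ * s + c))
      (fun f g => (hsum f).tsum_add (hsum g))
      (fun a f => tsum_mul_left)
      ⟨Finset.Iic (2, 0), 4 * ∑' s : ℤ, 1 / (1 + (Γ * s + c) ^ 2),
        mul_nonneg (by norm_num) (tsum_nonneg fun s => by positivity), fun f => by
          refine (tsum_of_norm_bounded (hw.hasSum.mul_left _)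
            (fun s => schwartz_weight f _)).trans (le_of_eq ?_)
          ring⟩
  refine ⟨ContinuousLinearMap.toPointwiseConvergenceCLM _ _ _ _ A, ?_⟩
  rw [HasSum, PointwiseConvergenceCLM.tendsto_iff_forall_tendsto]
  intro f
  have h : HasSum (fun s : ℤ => f (Γ * s + c)) (A f) := (hsum f).hasSum
  refine h.congr fun t => ?_
  rw [sum_apply]
  rfl

/-! ### The ideal and the approximate GKP states -/

/-- `α_d = √(2π/d)`. -/
def alphaD (d : ℕ) : ℝ := √(2 * Real.pi / d)

/-- The ideal state `|j⟩ = √(α_d d) ∑_{s ∈ ℤ} |α_d (d s + j)⟩_q`. -/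
def ideal (d j : ℕ) : 𝓢'(ℝ, ℂ) :=
  ((√(alphaD d * d) : ℝ) : ℂ) • ∑' s : ℤ, posKet (alphaD d * (d * s + j))

/-- `|j⟩` acts on Schwartz functions by `φ ↦ √(α_d d) ∑_s φ(α_d (d s + j))`. -/
theorem hasSum_ideal {d : ℕ} (hd : d ≠ 0) (j : ℕ) (φ : 𝓢(ℝ, ℂ)) :
    HasSum (fun s : ℤ => ((√(alphaD d * d) : ℝ) : ℂ) * φ (alphaD d * (d * s + j)))
      (ideal d j φ) := by
  have h0 : alphaD d * d ≠ 0 := by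
    have : (0 : ℝ) < d := by exact_mod_cast Nat.pos_of_ne_zero hd
    have h1 : 0 < alphaD d := Real.sqrt_pos.2 (by positivity)
    positivity
  have h := summable_posKet h0 (alphaD d * j)
  simp only [show ∀ s : ℤ, alphaD d * d * s + alphaD d * j = alphaD d * (d * s + j) from
    fun s => by ring] at h
  have h2 := PointwiseConvergenceCLM.tendsto_iff_forall_tendsto.1 h.hasSum φ
  have h3 : HasSum (fun s : ℤ => φ (alphaD d * (d * s + j)))
      ((∑' s : ℤ, posKet (alphaD d * (d * s + j))) φ) := by
    refine h2.congr fun t => ?_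
    rw [sum_apply]
    rfl
  exact h3.mul_left _

/-- The `s`-th term of the superposition in Approximation 1. -/
def term1 (d j : ℕ) (κ Δ : ℝ) (s : ℤ) : L2 :=
  ((Real.exp (-(1 / 2) * κ ^ 2 * alphaD d ^ 2 * (d * s + j) ^ 2) : ℝ) : ℂ) •
    (opX (alphaD d * (d * s + j)) (opS (-Real.log Δ) vacuum)).toLp 2 volume

/-- Approximation 1 before normalization. -/
def unnormalized1 (d j : ℕ) (κ Δ : ℝ) : L2 := ∑' s : ℤ, term1 d j κ Δ s

/-- The integrand of Approximation 2, `r = (r₁, r₂) = (r_p, r_q)`. -/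
def integrand2 (d j : ℕ) (γ δ : ℝ) (r : ℝ × ℝ) : 𝓢'(ℝ, ℂ) :=
  ((1 / (2 * Real.pi * γ * δ) *
    Real.exp (-(r.1 ^ 2 / (2 * γ ^ 2)) - r.2 ^ 2 / (2 * δ ^ 2)) : ℝ) : ℂ) •
    distV r (ideal d j)

/-- Approximation 2 before normalization. -/
def unnormalized2 (d j : ℕ) (γ δ : ℝ) : L2 := ketIntegral (integrand2 d j γ δ)

/-- The `n`-th term of the Fock expansion of `exp(-β (n̂ + 1/2)) |j⟩`, namely
`exp(-β (n + 1/2)) ⟨n|j⟩ |n⟩`. -/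
def term3 (d j : ℕ) (β : ℝ) (n : ℕ) : L2 :=
  (((Real.exp (-β * (n + 1 / 2)) : ℝ) : ℂ) * bracket (fock n) (ideal d j)) • (fock n).toLp 2 volume

/-- Approximation 3 before normalization, `exp(-β (n̂ + 1/2)) |j⟩`. -/
def unnormalized3 (d j : ℕ) (β : ℝ) : L2 := ∑' n : ℕ, term3 d j β n

/-- The normalization constants `N^(1)`, `N^(2)`, `N^(3)`. -/
def N1 (d j : ℕ) (κ Δ : ℝ) : ℝ := ‖unnormalized1 d j κ Δ‖ ^ 2
def N2 (d j : ℕ) (γ δ : ℝ) : ℝ := ‖unnormalized2 d j γ δ‖ ^ 2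
def N3 (d j : ℕ) (β : ℝ) : ℝ := ‖unnormalized3 d j β‖ ^ 2

/-- The approximate state `|j^(1)_{κ,Δ}⟩`. -/
def ket1 (d j : ℕ) (κ Δ : ℝ) : L2 :=
  ((1 / √(N1 d j κ Δ) : ℝ) : ℂ) • unnormalized1 d j κ Δ

/-- The approximate state `|j^(2)_{γ,δ}⟩`. -/
def ket2 (d j : ℕ) (γ δ : ℝ) : L2 :=
  ((1 / √(N2 d j γ δ) : ℝ) : ℂ) • unnormalized2 d j γ δ

/-- The approximate state `|j^(3)_β⟩`. -/
def ket3 (d j : ℕ) (β : ℝ) : L2 :=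
  ((1 / √(N3 d j β) : ℝ) : ℂ) • unnormalized3 d j β

/-! ### The functions in the position representations -/

/-- The Gaussian density `G_ν` of variance `ν`. -/
def gauss (ν x : ℝ) : ℝ := 1 / √(2 * Real.pi * ν) * Real.exp (-(x ^ 2 / (2 * ν)))

/-- The weighted Dirac comb `E_{μ,Γ,a}(x) = exp(-x²/(2μ)) ∑_{s ∈ ℤ} δ(x - (s + a) Γ)`, as a
measure. -/
def combE (μ Γ a : ℝ) : Measure ℝ :=
  (Measure.sum fun s : ℤ => Measure.dirac ((s + a) * Γ)).withDensity
    fun x => ENNReal.ofReal (Real.exp (-(x ^ 2 / (2 * μ))))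

/-- The convolution `E * g (q) = ∫ g(q - y) dE(y)` of a measure and a function. -/
def conv (E : Measure ℝ) (g : ℝ → ℝ) (q : ℝ) : ℝ := ∫ y, g (q - y) ∂E

/-- The theta function with characteristics `a`, `b`. -/
def theta (a b : ℝ) (z τ : ℂ) : ℂ :=
  ∑' s : ℤ, Complex.exp (Real.pi * Complex.I * τ * (s + a) ^ 2 +
    2 * Real.pi * Complex.I * (z + b) * (s + a))

/-- `λ(γ, δ) = 1 + γ² δ²/4`. -/
def lam (γ δ : ℝ) : ℝ := 1 + γ ^ 2 * δ ^ 2 / 4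

end

end GKP

namespace GKP

/-! ### Gaussian combs -/

/-! All three states have one normal form, a Gaussian-weighted Dirac comb convolved with a Gaussian.
The passage to theta functions is then a single computation (`conv_eq_theta`): completing the square
turns each summand into a Gaussian in `q` times a Gaussian in the lattice index, and Poisson
summation turns the lattice sum into a theta series.

The normal form arises as follows. In Approximation 1 the displaced squeezed vacua are already
Gaussians. In Approximation 2, tested on a Schwartz function, the `r₁`-integral is a Gaussian
characteristic function; the kernel left at a lattice point `a` is again Gaussian in `y`, with
variance `δ²/λ` and centre `ρ a` (`integral_displacedValue`, `displacement_kernel_eq`). In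
Approximation 3 the operator `exp(-β (n̂ + 1/2))` has the Mehler kernel (`hasSum_mehler`), a
Gaussian of variance `tanh β` about `a / cosh β`. Mehler's formula comes from writing Hermite
functions as Fourier integrals: the sum over `n` becomes an exponential inside a two-dimensional
Gaussian integral.

The analytic work is the exchange of limits. An `L²` sum is identified with the pointwise one by
`ae_eq_of_hasSum`; lattice sum and displacement integral commute by dominated convergence; Fock sum
and lattice sum commute by the bound `fock_bound`, itself a consequence of Mehler's formula on the
diagonal. Since the comb convolutions are strictly positive, the vectors are nonzero and can be
normalized. -/

theorem gauss_pos {ν : ℝ} (hν : 0 < ν) (x : ℝ) : 0 < gauss ν x := by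
  unfold gauss; positivity

theorem gauss_le {ν : ℝ} (hν : 0 < ν) (x : ℝ) : gauss ν x ≤ 1 / √(2 * Real.pi * ν) := by
  unfold gauss
  refine mul_le_of_le_one_right (by positivity) (Real.exp_le_one_iff.2 ?_)
  have : 0 ≤ x ^ 2 / (2 * ν) := by positivity
  linarith

theorem continuous_gauss (ν : ℝ) : Continuous (gauss ν) := by
  unfold gauss; fun_prop

theorem summable_exp_neg_sq {Γ : ℝ} (hΓ : Γ ≠ 0) (c : ℝ) :
    Summable (fun s : ℤ => Real.exp (-(Γ * s + c) ^ 2)) := by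
  refine Summable.of_nonneg_of_le (fun s => (Real.exp_pos _).le) (fun s => ?_)
    (summable_weight hΓ c)
  rw [Real.exp_neg, ← one_div]
  exact one_div_le_one_div_of_le (by positivity)
    (by linarith [Real.add_one_le_exp ((Γ * s + c) ^ 2)])

theorem summable_exp_comb {μ Γ : ℝ} (hμ : 0 < μ) (hΓ : Γ ≠ 0) (a : ℝ) :
    Summable (fun s : ℤ => Real.exp (-(((s + a) * Γ) ^ 2 / (2 * μ)))) := by
  have h := summable_exp_neg_sq (Γ := Γ / √(2 * μ)) (by positivity) (a * Γ / √(2 * μ))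
  refine h.congr fun s => ?_
  congr 2
  rw [show Γ / √(2 * μ) * s + a * Γ / √(2 * μ) = (s + a) * Γ / √(2 * μ) by ring, div_pow,
    Real.sq_sqrt (by positivity)]

/-- Integration against a sum of Dirac masses is summation over the nodes; the peak value of `gauss
ν` reduces convergence to that of the Gaussian weights. -/
theorem hasSum_conv {μ ν Γ : ℝ} (hμ : 0 < μ) (hν : 0 < ν) (hΓ : Γ ≠ 0) (a q : ℝ) :
    HasSum (fun s : ℤ => Real.exp (-(((s + a) * Γ) ^ 2 / (2 * μ))) *
      gauss ν (q - (s + a) * Γ)) (conv (combE μ Γ a) (gauss ν) q) := by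
  have hm : Measurable fun x : ℝ => ENNReal.ofReal (Real.exp (-(x ^ 2 / (2 * μ)))) := by fun_prop
  rw [conv, combE, integral_withDensity_eq_integral_toReal_smul hm (by simp)]
  have he : ∀ y : ℝ, (ENNReal.ofReal (Real.exp (-(y ^ 2 / (2 * μ))))).toReal • gauss ν (q - y) =
      Real.exp (-(y ^ 2 / (2 * μ))) * gauss ν (q - y) := fun y => by
    rw [ENNReal.toReal_ofReal (Real.exp_pos _).le, smul_eq_mul]
  simp only [he]
  have hs : Summable (fun s : ℤ => Real.exp (-(((s + a) * Γ) ^ 2 / (2 * μ))) *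
      gauss ν (q - (s + a) * Γ)) :=
    Summable.of_nonneg_of_le
      (fun s => mul_nonneg (Real.exp_pos _).le (gauss_pos hν _).le)
      (fun s => mul_le_mul_of_nonneg_left (gauss_le hν _) (Real.exp_pos _).le)
      ((summable_exp_comb hμ hΓ a).mul_right _)
  have hi := hasSum_integral_measure (integrable_sum_measure
    (μ := fun s : ℤ => Measure.dirac (((s : ℝ) + a) * Γ))
    (f := fun y => Real.exp (-(y ^ 2 / (2 * μ))) * gauss ν (q - y))
    (fun s => integrable_dirac enorm_lt_top) ?_)
  · simpa only [integral_dirac] using hi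
  · refine hs.congr fun s => ?_
    rw [integral_dirac, Real.norm_of_nonneg]
    exact mul_nonneg (Real.exp_pos _).le (gauss_pos hν _).le

theorem conv_pos {μ ν Γ : ℝ} (hμ : 0 < μ) (hν : 0 < ν) (hΓ : Γ ≠ 0) (a q : ℝ) :
    0 < conv (combE μ Γ a) (gauss ν) q := by
  have h := hasSum_conv hμ hν hΓ a q
  have h0 : ∀ s : ℤ, 0 < Real.exp (-(((s + a) * Γ) ^ 2 / (2 * μ))) *
      gauss ν (q - (s + a) * Γ) := fun s => mul_pos (Real.exp_pos _) (gauss_pos hν _)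
  rw [← h.tsum_eq]
  exact h.summable.tsum_pos (fun s => (h0 s).le) 0 (h0 0)

/-- Poisson summation for the theta function with real characteristic on the imaginary axis. -/
theorem theta_eq_tsum {t : ℝ} (ht : 0 < t) (b z : ℝ) :
    theta 0 b z (Complex.I * t) =
      ((1 / √t * ∑' n : ℤ, Real.exp (-(Real.pi / t * (n + b + z) ^ 2)) : ℝ) : ℂ) := by
  have h := Complex.tsum_exp_neg_quadratic (a := (t : ℂ)) (by simpa using ht)
    (Complex.I * ((z : ℂ) + b))
  have h1 : theta 0 b z (Complex.I * t) = ∑' n : ℤ, Complex.exp (-Real.pi * (t : ℂ) * (n : ℂ) ^ 2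
      + 2 * Real.pi * (Complex.I * ((z : ℂ) + b)) * n) := by
    unfold theta
    refine tsum_congr fun n => ?_
    congr 1
    push_cast
    linear_combination (Real.pi * (t : ℂ) * n ^ 2) * Complex.I_sq
  rw [h1, h, Complex.ofReal_mul, Complex.ofReal_tsum]
  congr 1
  · rw [Real.sqrt_eq_rpow]
    push_cast
    rw [Complex.ofReal_cpow ht.le]
    push_cast
    rfl
  -- The dual series runs over squares of `n - (z + b)`; the reflection `n ↦ -n` restores the sign.
  · rw [← (Equiv.neg ℤ).tsum_eq]
    refine tsum_congr fun n => ?_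
    simp only [Equiv.neg_apply]
    push_cast
    congr 1
    rw [show Complex.I * (Complex.I * ((z : ℂ) + b)) = -((z : ℂ) + b) by
      linear_combination ((z : ℂ) + b) * Complex.I_sq]
    ring

/-- Bayes' rule for Gaussians: the marginal of `q` has variance `μ + ν`, and given `q` the variable
`x` has mean `q μ / (μ + ν)` and variance `μ ν / (μ + ν)`. -/
theorem gauss_mul_gauss {μ ν : ℝ} (hμ : 0 < μ) (hν : 0 < ν) (x q : ℝ) :
    Real.exp (-(x ^ 2 / (2 * μ))) * gauss ν (q - x) =
      √((μ + ν) / ν) * gauss (μ + ν) q *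
        Real.exp (-((μ + ν) / (2 * (μ * ν)) * (x - q * μ / (μ + ν)) ^ 2)) := by
  have hexp : Real.exp (-(x ^ 2 / (2 * μ))) * Real.exp (-((q - x) ^ 2 / (2 * ν))) =
      Real.exp (-(q ^ 2 / (2 * (μ + ν)))) *
        Real.exp (-((μ + ν) / (2 * (μ * ν)) * (x - q * μ / (μ + ν)) ^ 2)) := by
    rw [← Real.exp_add, ← Real.exp_add]
    congr 1
    field_simp
    ring
  have hs : 1 / √(2 * Real.pi * ν) = √((μ + ν) / ν) * (1 / √(2 * Real.pi * (μ + ν))) := by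
    rw [one_div, one_div, ← Real.sqrt_inv, ← Real.sqrt_inv, ← Real.sqrt_mul (by positivity)]
    congr 1
    field_simp
  unfold gauss
  rw [hs]
  linear_combination (√((μ + ν) / ν) * (1 / √(2 * Real.pi * (μ + ν)))) * hexp

/-- A weighted Dirac comb convolved with a Gaussian is a Gaussian times a theta function. -/
theorem conv_eq_theta {μ ν Γ : ℝ} (hμ : 0 < μ) (hν : 0 < ν) (hΓ : 0 < Γ) (a q : ℝ) :
    ((conv (combE μ Γ a) (gauss ν) q : ℝ) : ℂ) =
      ((√(2 * Real.pi * μ) / Γ * gauss (μ + ν) q : ℝ) : ℂ) *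
        theta 0 a ((-(q * μ / ((μ + ν) * Γ)) : ℝ) : ℂ)
          (Complex.I * ((2 * Real.pi * (μ * ν) / ((μ + ν) * Γ ^ 2) : ℝ) : ℂ)) := by
  rw [theta_eq_tsum (by positivity), ← (hasSum_conv hμ hν hΓ.ne' a q).tsum_eq,
    ← Complex.ofReal_mul]
  congr 1
  -- Measured in units of `Γ`, the completed square is the summand of the Poisson-dual series; this
  -- fixes both arguments of the theta function.
  have hterm : ∀ s : ℤ, Real.exp (-(((s + a) * Γ) ^ 2 / (2 * μ))) * gauss ν (q - (s + a) * Γ) =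
      √((μ + ν) / ν) * gauss (μ + ν) q *
        Real.exp (-(Real.pi / (2 * Real.pi * (μ * ν) / ((μ + ν) * Γ ^ 2)) *
          (s + a + -(q * μ / ((μ + ν) * Γ))) ^ 2)) := fun s => by
    rw [gauss_mul_gauss hμ hν]
    congr 3
    field_simp
    ring
  simp only [hterm]
  rw [tsum_mul_left, ← mul_assoc (√(2 * Real.pi * μ) / Γ * gauss (μ + ν) q)]
  congr 1
  rw [mul_right_comm (√(2 * Real.pi * μ) / Γ)]
  congr 1
  rw [one_div, ← Real.sqrt_inv, div_mul_eq_mul_div, ← Real.sqrt_mul (by positivity),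
    eq_div_iff hΓ.ne']
  nth_rw 1 [← Real.sqrt_sq hΓ.le]
  rw [← Real.sqrt_mul (by positivity)]
  congr 1
  field_simp

/-! ### Sums in `L²` -/

/-- Convergence in `L²` implies convergence in measure, hence almost everywhere along a sequence of
finite index sets; along it the partial sums also tend to the pointwise sum. -/
theorem ae_eq_of_hasSum {ι : Type*} [Countable ι] {f : ι → L2} {Ψ : L2} (h : HasSum f Ψ)
    {g : ι → ℝ → ℂ} {G : ℝ → ℂ} (hg : ∀ i, f i =ᵐ[volume] g i)
    (hG : ∀ q, HasSum (fun i => g i q) (G q)) : Ψ =ᵐ[volume] G := by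
  obtain ⟨ns, hns, hae⟩ := (tendstoInMeasure_of_tendsto_Lp h).exists_seq_tendsto_ae'
  have hsum : ∀ s : Finset ι, (∑ i ∈ s, f i : L2) =ᵐ[volume] fun q => ∑ i ∈ s, g i q := by
    intro s
    refine (Lp.coeFn_finsetSum s f).trans ?_
    filter_upwards [ae_all_iff.2 hg] with q hq
    simp [hq]
  filter_upwards [hae, ae_all_iff.2 hsum] with q h1 h2
  refine tendsto_nhds_unique h1 ?_
  simp only [h2]
  exact (hG q).comp hns

/-- A representative that vanishes nowhere forces `u ≠ 0`; the norm is then absorbed into the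
prefactor by `C / ‖u‖ = √(C² / ‖u‖²)`. -/
theorem normalize_of_ae_eq {u : L2} {C : ℝ} (hC : 0 < C) {c : ℝ → ℝ} (hc : ∀ q, 0 < c q)
    (hu : u =ᵐ[volume] fun q => ((C * c q : ℝ) : ℂ)) :
    0 < ‖u‖ ^ 2 ∧ ‖((1 / √(‖u‖ ^ 2) : ℝ) : ℂ) • u‖ = 1 ∧
      ∀ᵐ q : ℝ, (((1 / √(‖u‖ ^ 2) : ℝ) : ℂ) • u : L2) q =
        ((√(C ^ 2 / ‖u‖ ^ 2) * c q : ℝ) : ℂ) := by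
  have h0 : u ≠ 0 := by
    rintro rfl
    have h := (Lp.coeFn_zero ℂ 2 (volume : Measure ℝ)).symm.trans hu
    obtain ⟨q, hq⟩ := h.exists
    have : C * c q = 0 := Complex.ofReal_eq_zero.1 hq.symm
    exact (mul_pos hC (hc q)).ne' this
  have hn : 0 < ‖u‖ := norm_pos_iff.2 h0
  refine ⟨by positivity, ?_, ?_⟩
  · rw [norm_smul, Real.sqrt_sq hn.le, Complex.norm_real, Real.norm_of_nonneg (by positivity)]
    field_simp
  · filter_upwards [hu, Lp.coeFn_smul ((1 / √(‖u‖ ^ 2) : ℝ) : ℂ) u] with q h1 h2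
    rw [h2, Pi.smul_apply, h1, smul_eq_mul, ← Complex.ofReal_mul, Real.sqrt_div (by positivity),
      Real.sqrt_sq hC.le]
    congr 1
    ring

/-! ### Displaced squeezed vacua -/

/-- The factor `√(2√(π w²))` converts the probability density `gauss (w ^ 2)` into a function of
unit `L²` norm. -/
theorem opX_opS_vacuum_apply {w : ℝ} (hw : 0 < w) (c x : ℝ) :
    opX c (opS (-Real.log w) vacuum) x =
      ((√(2 * √(Real.pi * w ^ 2)) * gauss (w ^ 2) (x - c) : ℝ) : ℂ) := by
  rw [opX_apply, opS_apply, vacuum_apply, ← Complex.ofReal_mul]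
  congr 1
  have h1 : Real.exp (-Real.log w) = w⁻¹ := by rw [Real.exp_neg, Real.exp_log hw]
  have h2 : Real.exp (-Real.log w / 2) = √(w⁻¹) := by
    rw [← h1, ← Real.exp_half]
  have h3 : Real.pi ^ (-(1 / 4 : ℝ)) = √(√(Real.pi⁻¹)) := by
    rw [Real.sqrt_eq_rpow, Real.sqrt_eq_rpow, ← Real.rpow_mul (by positivity),
      Real.inv_rpow Real.pi_pos.le, ← Real.rpow_neg Real.pi_pos.le]
    norm_num
  rw [h1, h2, h3, gauss, ← mul_assoc, ← mul_assoc]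
  congr 1
  · rw [one_div, ← Real.sqrt_inv, ← Real.sqrt_mul (by positivity), ← Real.sqrt_mul (by positivity)]
    congr 1
    have hp := Real.sq_sqrt Real.pi_pos.le
    rw [Real.sqrt_mul Real.pi_pos.le, Real.sqrt_sq hw.le, Real.sqrt_inv]
    field_simp
    linear_combination -hp
  · congr 1
    field_simp

theorem norm_toLp_opX (c : ℝ) (f : 𝓢(ℝ, ℂ)) :
    ‖(opX c f).toLp 2 volume‖ = ‖f.toLp 2 volume‖ := by
  rw [SchwartzMap.norm_toLp, SchwartzMap.norm_toLp]
  congr 1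
  exact eLpNorm_comp_measurePreserving f.continuous.aestronglyMeasurable
    (measurePreserving_sub_right volume c)

/-- The displaced squeezed vacuum of width `w` centred at `c`. -/
noncomputable def packet (w c : ℝ) : L2 := (opX c (opS (-Real.log w) vacuum)).toLp 2 volume

theorem packet_ae_eq {w : ℝ} (hw : 0 < w) (c : ℝ) : packet w c =ᵐ[volume]
    fun x => ((√(2 * √(Real.pi * w ^ 2)) * gauss (w ^ 2) (x - c) : ℝ) : ℂ) := by
  filter_upwards [SchwartzMap.coeFn_toLp (opX c (opS (-Real.log w) vacuum)) 2 volume] with x hx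
  rw [packet, hx, opX_opS_vacuum_apply hw]

/-- Translations are isometries, so all packets have the same norm and absolute convergence is that
of the weights. -/
theorem summable_comb_packet {μ Γ : ℝ} (hμ : 0 < μ) (hΓ : Γ ≠ 0) (w a : ℝ) :
    Summable (fun s : ℤ => ((Real.exp (-(((s + a) * Γ) ^ 2 / (2 * μ))) : ℝ) : ℂ) •
      packet w ((s + a) * Γ)) := by
  refine Summable.of_norm ?_
  refine ((summable_exp_comb hμ hΓ a).mul_right
    ‖(opS (-Real.log w) vacuum).toLp 2 volume‖).congr fun s => ?_
  rw [norm_smul, packet, norm_toLp_opX, Complex.norm_real,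
    Real.norm_of_nonneg (Real.exp_pos _).le]

theorem tsum_comb_packet_ae_eq {μ Γ w : ℝ} (hμ : 0 < μ) (hΓ : Γ ≠ 0) (hw : 0 < w) (a : ℝ) :
    (∑' s : ℤ, ((Real.exp (-(((s + a) * Γ) ^ 2 / (2 * μ))) : ℝ) : ℂ) •
      packet w ((s + a) * Γ) : L2) =ᵐ[volume]
    fun q => ((√(2 * √(Real.pi * w ^ 2)) * conv (combE μ Γ a) (gauss (w ^ 2)) q : ℝ) : ℂ) := by
  refine ae_eq_of_hasSum (summable_comb_packet hμ hΓ w a).hasSum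
    (g := fun s q => ((√(2 * √(Real.pi * w ^ 2)) * (Real.exp (-(((s + a) * Γ) ^ 2 / (2 * μ))) *
      gauss (w ^ 2) (q - (s + a) * Γ)) : ℝ) : ℂ)) (fun s => ?_) (fun q => ?_)
  · filter_upwards [packet_ae_eq hw ((s + a) * Γ), Lp.coeFn_smul
      ((Real.exp (-(((s + a) * Γ) ^ 2 / (2 * μ))) : ℝ) : ℂ) (packet w ((s + a) * Γ))] with q h1 h2
    rw [h2, Pi.smul_apply, h1, smul_eq_mul, ← Complex.ofReal_mul]
    congr 1
    ring
  · exact Complex.hasSum_ofReal.2 ((hasSum_conv hμ (by positivity) hΓ a q).mul_left _)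

/-! ### The lattice spacing -/

theorem alphaD_pos {d : ℕ} (hd : 0 < d) : 0 < alphaD d := by
  unfold alphaD; positivity

theorem alphaD_sq_mul {d : ℕ} (hd : 0 < d) : alphaD d ^ 2 * d = 2 * Real.pi := by
  unfold alphaD
  rw [Real.sq_sqrt (by positivity)]
  field_simp

/-! ### Gaussian integrals -/

theorem integral_cexp_neg_quadratic {b : ℝ} (hb : 0 < b) (c d : ℂ) :
    ∫ x : ℝ, Complex.exp (-(b : ℂ) * x ^ 2 + c * x + d) =
      ((√(Real.pi / b) : ℝ) : ℂ) * Complex.exp (d + c ^ 2 / (4 * b)) := by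
  rw [integral_cexp_quadratic (by simpa using hb), neg_neg]
  congr 1
  · rw [← Complex.ofReal_div, Real.sqrt_eq_rpow, Complex.ofReal_cpow (by positivity)]
    norm_num
  · congr 1
    ring

theorem integral_gauss_mul_cexp {ν : ℝ} (hν : 0 < ν) (u : ℝ) :
    ∫ r : ℝ, ((gauss ν r : ℝ) : ℂ) * Complex.exp (Complex.I * r * u) =
      ((Real.exp (-(ν * u ^ 2 / 2)) : ℝ) : ℂ) := by
  have h : ∀ r : ℝ, ((gauss ν r : ℝ) : ℂ) * Complex.exp (Complex.I * r * u) =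
      ((1 / √(2 * Real.pi * ν) : ℝ) : ℂ) *
        Complex.exp (-((1 / (2 * ν) : ℝ) : ℂ) * r ^ 2 + (Complex.I * u) * r + 0) := fun r => by
    rw [gauss, Complex.ofReal_mul, mul_assoc, Complex.ofReal_exp, ← Complex.exp_add]
    congr 2
    push_cast
    ring
  simp only [h]
  rw [integral_const_mul, integral_cexp_neg_quadratic (by positivity), ← mul_assoc,
    ← Complex.ofReal_mul]
  have h1 : 1 / √(2 * Real.pi * ν) * √(Real.pi / (1 / (2 * ν))) = 1 := by
    rw [show Real.pi / (1 / (2 * ν)) = 2 * Real.pi * ν by field_simp]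
    exact one_div_mul_cancel (by positivity)
  rw [h1, Complex.ofReal_one, one_mul, Complex.ofReal_exp]
  congr 1
  have : (ν : ℂ) ≠ 0 := by exact_mod_cast hν.ne'
  push_cast
  field_simp
  rw [Complex.I_sq]
  ring

theorem integrable_gauss {ν : ℝ} (hν : 0 < ν) : Integrable (gauss ν) := by
  have h := (integrable_exp_neg_mul_sq (b := 1 / (2 * ν)) (by positivity)).const_mul
    (1 / √(2 * Real.pi * ν))
  refine h.congr (ae_of_all _ fun x => ?_)
  simp only [gauss]
  congr 2
  ring

theorem integrable_one_add_sq_mul_gauss {ν : ℝ} (hν : 0 < ν) :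
    Integrable (fun x => (1 + x ^ 2) * gauss ν x) := by
  have h := (integrable_rpow_mul_exp_neg_mul_sq (b := 1 / (2 * ν)) (by positivity)
    (s := 2) (by norm_num)).const_mul (1 / √(2 * Real.pi * ν))
  refine ((integrable_gauss hν).add h).congr (ae_of_all _ fun x => ?_)
  simp only [gauss, Pi.add_apply, Real.rpow_two]
  rw [show -(1 / (2 * ν)) * x ^ 2 = -(x ^ 2 / (2 * ν)) by ring]
  ring

/-- Peetre's inequality. It separates the lattice point `a` from the displacement `r`, at the price
of a factor that a Gaussian in `r` absorbs. -/
theorem one_add_sq_le (a r : ℝ) :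
    1 / (1 + (a + r) ^ 2) ≤ 2 * (1 + r ^ 2) * (1 / (1 + a ^ 2)) := by
  rw [mul_one_div, div_le_div_iff₀ (by positivity) (by positivity)]
  nlinarith [sq_nonneg (a + 2 * r), sq_nonneg (r * (a + r)), sq_nonneg r]

/-! ### Gaussian superpositions of displacements -/

/-- The contribution of the position ket at `a` to the Gaussian average of displacements. -/
noncomputable def displacedValue (γ δ : ℝ) (φ : 𝓢(ℝ, ℂ)) (a : ℝ) (r : ℝ × ℝ) : ℂ :=
  ((gauss (γ ^ 2) r.1 : ℝ) : ℂ) * Complex.exp (Complex.I * r.1 * ((a + r.2 / 2 : ℝ) : ℂ)) *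
    (((gauss (δ ^ 2) r.2 : ℝ) : ℂ) * φ (a + r.2))

/-- Both parameters may be negative, so only the product `γ δ` is taken out of the square root. -/
theorem gaussian_weight_eq {γ δ : ℝ} (h : 0 < γ * δ) (r : ℝ × ℝ) :
    1 / (2 * Real.pi * γ * δ) * Real.exp (-(r.1 ^ 2 / (2 * γ ^ 2)) - r.2 ^ 2 / (2 * δ ^ 2)) =
      gauss (γ ^ 2) r.1 * gauss (δ ^ 2) r.2 := by
  have h1 : √(2 * Real.pi * γ ^ 2) * √(2 * Real.pi * δ ^ 2) = 2 * Real.pi * γ * δ := by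
    rw [← Real.sqrt_mul (by positivity),
      show 2 * Real.pi * γ ^ 2 * (2 * Real.pi * δ ^ 2) = (2 * Real.pi * (γ * δ)) ^ 2 by ring,
      Real.sqrt_sq (by positivity)]
    ring
  rw [gauss, gauss, sub_eq_add_neg, Real.exp_add, ← h1]
  ring

/-- The Weyl phase `-r₁ r₂ / 2` combines with the phase `r₁ (a + r₂)` of the displaced position ket
to `r₁ (a + r₂ / 2)`. -/
theorem hasSum_integrand2 {d : ℕ} (hd : d ≠ 0) (j : ℕ) {γ δ : ℝ} (h : 0 < γ * δ)
    (φ : 𝓢(ℝ, ℂ)) (r : ℝ × ℝ) :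
    HasSum (fun s : ℤ => ((√(alphaD d * d) : ℝ) : ℂ) *
      displacedValue γ δ φ (alphaD d * (d * s + j)) r) (integrand2 d j γ δ r φ) := by
  have h1 := (hasSum_ideal hd j (opX (-r.2) (opZ r.1 φ))).mul_left
    (((gauss (γ ^ 2) r.1 * gauss (δ ^ 2) r.2 : ℝ) : ℂ) *
      Complex.exp (-Complex.I * (r.1 : ℂ) * (r.2 : ℂ) / 2))
  have h2 : integrand2 d j γ δ r φ =
      (((gauss (γ ^ 2) r.1 * gauss (δ ^ 2) r.2 : ℝ) : ℂ) *
        Complex.exp (-Complex.I * (r.1 : ℂ) * (r.2 : ℂ) / 2)) *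
        ideal d j (opX (-r.2) (opZ r.1 φ)) := by
    rw [integrand2, gaussian_weight_eq h, mul_assoc]
    rfl
  rw [h2]
  refine (congrArg (HasSum · _) (funext fun s => ?_)).mpr h1
  rw [displacedValue, opX_apply, opZ_apply, sub_neg_eq_add]
  have he : Complex.exp (Complex.I * r.1 * ((alphaD d * (d * s + j) + r.2 / 2 : ℝ) : ℂ)) =
      Complex.exp (-Complex.I * (r.1 : ℂ) * (r.2 : ℂ) / 2) *
        Complex.exp (Complex.I * r.1 * ((alphaD d * (d * s + j) + r.2 : ℝ) : ℂ)) := by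
    rw [← Complex.exp_add]
    congr 1
    push_cast
    ring
  rw [he]
  push_cast
  ring

/-- The bound is a product of a factor summable over the lattice and a factor integrable in `r`, as
dominated convergence for the lattice series requires. -/
theorem norm_displacedValue_le {γ δ : ℝ} (hγ : γ ≠ 0) (hδ : δ ≠ 0) (φ : 𝓢(ℝ, ℂ)) :
    ∃ K : ℝ, ∀ (a : ℝ) (r : ℝ × ℝ), ‖displacedValue γ δ φ a r‖ ≤
      1 / (1 + a ^ 2) * (K * (gauss (γ ^ 2) r.1 * ((1 + r.2 ^ 2) * gauss (δ ^ 2) r.2))) := by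
  set K := 4 * ((Finset.Iic (2, 0)).sup (schwartzSeminormFamily ℂ ℝ ℂ)) φ with hK
  have hK0 : 0 ≤ K := mul_nonneg (by norm_num) (apply_nonneg _ _)
  refine ⟨2 * K, fun a r => ?_⟩
  have h1 := gauss_pos (show 0 < γ ^ 2 by positivity) r.1
  have h2 := gauss_pos (show 0 < δ ^ 2 by positivity) r.2
  have h3 : ‖φ (a + r.2)‖ ≤ K * (2 * (1 + r.2 ^ 2) * (1 / (1 + a ^ 2))) :=
    (schwartz_weight φ (a + r.2)).trans
      (mul_le_mul_of_nonneg_left (one_add_sq_le a r.2) hK0)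
  have h4 : ‖Complex.exp (Complex.I * r.1 * ((a + r.2 / 2 : ℝ) : ℂ))‖ = 1 := by
    rw [show Complex.I * r.1 * ((a + r.2 / 2 : ℝ) : ℂ) =
      ((r.1 * (a + r.2 / 2) : ℝ) : ℂ) * Complex.I by push_cast; ring,
      Complex.norm_exp_ofReal_mul_I]
  rw [displacedValue, norm_mul, norm_mul, norm_mul, h4, Complex.norm_real, Complex.norm_real,
    Real.norm_of_nonneg h1.le, Real.norm_of_nonneg h2.le, mul_one]
  calc _ ≤ gauss (γ ^ 2) r.1 *
        (gauss (δ ^ 2) r.2 * (K * (2 * (1 + r.2 ^ 2) * (1 / (1 + a ^ 2))))) := by gcongr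
    _ = _ := by ring

theorem integrable_displacement_weight {γ δ : ℝ} (hγ : γ ≠ 0) (hδ : δ ≠ 0) :
    Integrable (fun r : ℝ × ℝ => gauss (γ ^ 2) r.1 * ((1 + r.2 ^ 2) * gauss (δ ^ 2) r.2)) :=
  (integrable_gauss (show 0 < γ ^ 2 by positivity)).mul_prod
    (integrable_one_add_sq_mul_gauss (show 0 < δ ^ 2 by positivity))

theorem continuous_displacedValue (γ δ : ℝ) (φ : 𝓢(ℝ, ℂ)) (a : ℝ) :
    Continuous (displacedValue γ δ φ a) := by
  have h1 := continuous_gauss (γ ^ 2)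
  have h2 := continuous_gauss (δ ^ 2)
  have h3 := φ.continuous
  unfold displacedValue
  fun_prop

theorem integrable_displacedValue {γ δ : ℝ} (hγ : γ ≠ 0) (hδ : δ ≠ 0) (φ : 𝓢(ℝ, ℂ)) (a : ℝ) :
    Integrable (displacedValue γ δ φ a) := by
  obtain ⟨K, hK⟩ := norm_displacedValue_le hγ hδ φ
  exact (((integrable_displacement_weight hγ hδ).const_mul K).const_mul (1 / (1 + a ^ 2))).mono'
    (continuous_displacedValue γ δ φ a).aestronglyMeasurable (ae_of_all _ (hK a))

/-- Averaging the displaced position ket at `a` over Gaussian displacements. -/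
theorem integral_displacedValue {γ δ : ℝ} (hγ : γ ≠ 0) (hδ : δ ≠ 0) (φ : 𝓢(ℝ, ℂ)) (a : ℝ) :
    ∫ r, displacedValue γ δ φ a r = ∫ y : ℝ, φ y *
      ((gauss (δ ^ 2) (y - a) * Real.exp (-(γ ^ 2 * (a + y) ^ 2 / 8)) : ℝ) : ℂ) := by
  -- The `r₁`-integral is done first, as a Gaussian characteristic function at `a + r₂ / 2`; then
  -- `r₂ = y - a` makes this point `(a + y) / 2`.
  rw [Measure.volume_eq_prod, integral_prod_symm _ (integrable_displacedValue hγ hδ φ a)]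
  simp only [displacedValue]
  simp only [integral_mul_const, integral_gauss_mul_cexp (show 0 < γ ^ 2 by positivity)]
  rw [← integral_sub_right_eq_self _ a]
  congr 1
  funext y
  rw [add_sub_cancel]
  push_cast
  rw [show -((γ : ℂ) ^ 2 * (a + (y - a) / 2) ^ 2 / 2) = -(γ ^ 2 * (a + y) ^ 2 / 8) by ring]
  ring

theorem lam_pos (γ δ : ℝ) : 0 < lam γ δ := by
  unfold lam; positivity

/-- Completing the square in the averaged displacement kernel. -/
theorem displacement_kernel_eq {γ δ : ℝ} (hγ : γ ≠ 0) (hδ : δ ≠ 0)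
    (hρ : 0 < 1 - γ ^ 2 * δ ^ 2 / (2 * lam γ δ)) (a y : ℝ) :
    gauss (δ ^ 2) (y - a) * Real.exp (-(γ ^ 2 * (a + y) ^ 2 / 8)) =
      1 / √(lam γ δ) * (Real.exp (-((a * (1 - γ ^ 2 * δ ^ 2 / (2 * lam γ δ))) ^ 2 /
        (2 * (lam γ δ / γ ^ 2 * (1 - γ ^ 2 * δ ^ 2 / (2 * lam γ δ)) ^ 2)))) *
        gauss (δ ^ 2 / lam γ δ) (y - a * (1 - γ ^ 2 * δ ^ 2 / (2 * lam γ δ)))) := by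
  have hl : 0 < lam γ δ := lam_pos γ δ
  set ρ := 1 - γ ^ 2 * δ ^ 2 / (2 * lam γ δ) with hρdef
  have hs : 1 / √(2 * Real.pi * δ ^ 2) =
      1 / √(lam γ δ) * (1 / √(2 * Real.pi * (δ ^ 2 / lam γ δ))) := by
    rw [div_mul_div_comm, one_mul, ← Real.sqrt_mul hl.le]
    congr 2
    field_simp
  -- The coefficient of `y²` is `1/(2δ²) + γ²/8 = λ/(2δ²)` and the vertex is `a (1 - γ²δ²/4)/λ = a
  -- ρ`. The remainder `a²γ²/(2λ)` is expressed through the contracted node `a ρ`, which needs `ρ ≠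
  -- 0`.
  have hexp : Real.exp (-((y - a) ^ 2 / (2 * δ ^ 2))) * Real.exp (-(γ ^ 2 * (a + y) ^ 2 / 8)) =
      Real.exp (-((a * ρ) ^ 2 / (2 * (lam γ δ / γ ^ 2 * ρ ^ 2)))) *
        Real.exp (-((y - a * ρ) ^ 2 / (2 * (δ ^ 2 / lam γ δ)))) := by
    rw [← Real.exp_add, ← Real.exp_add]
    congr 1
    have e1 : (a * ρ) ^ 2 / (2 * (lam γ δ / γ ^ 2 * ρ ^ 2)) = a ^ 2 * γ ^ 2 / (2 * lam γ δ) := by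
      field_simp
    rw [e1, hρdef]
    unfold lam at hl ⊢
    field_simp
    ring
  rw [gauss, gauss, hs]
  linear_combination (1 / √(lam γ δ) * (1 / √(2 * Real.pi * (δ ^ 2 / lam γ δ)))) * hexp

theorem lp_apply_hasSum {ι : Type*} {f : ι → L2} {Ψ : L2} (h : HasSum f Ψ) (φ : 𝓢(ℝ, ℂ)) :
    HasSum (fun i => (f i : 𝓢'(ℝ, ℂ)) φ) ((Ψ : 𝓢'(ℝ, ℂ)) φ) := by
  have h1 := h.mapL (Lp.toTemperedDistributionCLM ℂ (volume : Measure ℝ) 2)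
  have h2 := PointwiseConvergenceCLM.tendsto_iff_forall_tendsto.1 h1 φ
  refine h2.congr fun t => ?_
  rw [sum_apply]
  rfl

/-- Tested on `φ`, both sides are lattice series with equal terms. The divisor `√(2√(π ·))` in the
coefficients undoes the `L²` normalization of the packets. -/
theorem hasKetIntegral_integrand2 {d : ℕ} (hd : d ≠ 0) (j : ℕ) {γ δ : ℝ} (h : 0 < γ * δ)
    (hρ : 0 < 1 - γ ^ 2 * δ ^ 2 / (2 * lam γ δ)) {Ψ : L2}
    (hΨ : HasSum (fun s : ℤ => (((√(alphaD d * d) / √(lam γ δ) /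
      √(2 * √(Real.pi * √(δ ^ 2 / lam γ δ) ^ 2)) : ℝ) : ℂ) •
      ((Real.exp (-(((s + j / d) * (alphaD d * d * (1 - γ ^ 2 * δ ^ 2 / (2 * lam γ δ)))) ^ 2 /
        (2 * (lam γ δ / γ ^ 2 * (1 - γ ^ 2 * δ ^ 2 / (2 * lam γ δ)) ^ 2)))) : ℝ) : ℂ) •
      packet (√(δ ^ 2 / lam γ δ))
        ((s + j / d) * (alphaD d * d * (1 - γ ^ 2 * δ ^ 2 / (2 * lam γ δ)))) : L2)) Ψ) :
    HasKetIntegral (integrand2 d j γ δ) Ψ := by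
  intro φ
  have hγ : γ ≠ 0 := by rintro rfl; simp at h
  have hδ : δ ≠ 0 := by rintro rfl; simp at h
  have hl : 0 < lam γ δ := lam_pos γ δ
  have hd0 : (0 : ℝ) < d := by exact_mod_cast Nat.pos_of_ne_zero hd
  have hα : 0 < alphaD d := alphaD_pos (Nat.pos_of_ne_zero hd)
  obtain ⟨K, hK⟩ := norm_displacedValue_le hγ hδ φ
  set c : ℝ := √(alphaD d * d) with hc
  have hc0 : 0 ≤ c := Real.sqrt_nonneg _
  have hw : Summable (fun s : ℤ => 1 / (1 + (alphaD d * (d * s + j)) ^ 2)) :=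
    (summable_weight (Γ := alphaD d * d) (by positivity) (alphaD d * j)).congr fun s => by
      rw [show alphaD d * d * s + alphaD d * j = alphaD d * (d * s + j) by ring]
  set W : ℝ × ℝ → ℝ := fun r =>
    K * (gauss (γ ^ 2) r.1 * ((1 + r.2 ^ 2) * gauss (δ ^ 2) r.2)) with hW
  have hWi : Integrable W := (integrable_displacement_weight hγ hδ).const_mul K
  have hF := hasSum_integrand2 hd j h φ
  have hbound : ∀ (s : ℤ) (r : ℝ × ℝ),
      ‖(c : ℂ) * displacedValue γ δ φ (alphaD d * (d * s + j)) r‖ ≤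
        1 / (1 + (alphaD d * (d * s + j)) ^ 2) * (c * W r) := fun s r => by
    rw [norm_mul, Complex.norm_real, Real.norm_of_nonneg hc0]
    calc _ ≤ c * _ := mul_le_mul_of_nonneg_left (hK _ r) hc0
      _ = _ := by rw [hW]; ring
  have hmeas : ∀ s : ℤ, AEStronglyMeasurable
      (fun r => (c : ℂ) * displacedValue γ δ φ (alphaD d * (d * s + j)) r) volume := fun s =>
    ((continuous_displacedValue γ δ φ _).const_mul _).aestronglyMeasurable
  -- Measurability in `r` is inherited from the continuous finite partial sums.
  have hFm : AEStronglyMeasurable (fun r => integrand2 d j γ δ r φ) volume :=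
    aestronglyMeasurable_of_tendsto_ae (Filter.atTop : Filter (Finset ℤ))
      (f := fun (t : Finset ℤ) r =>
        ∑ s ∈ t, (c : ℂ) * displacedValue γ δ φ (alphaD d * (d * s + j)) r)
      (fun t => t.aestronglyMeasurable_fun_sum fun s _ => hmeas s) (ae_of_all _ hF)
  have hFi : Integrable (fun r => integrand2 d j γ δ r φ) :=
    ((hWi.const_mul c).const_mul (∑' s : ℤ, 1 / (1 + (alphaD d * (d * s + j)) ^ 2))).mono' hFm
      (ae_of_all _ fun r => by
        rw [← (hF r).tsum_eq]
        exact tsum_of_norm_bounded (hw.hasSum.mul_right _) fun s => hbound s r)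
  refine ⟨hFi, ?_⟩
  have hI := hasSum_integral_of_dominated_convergence
    (F := fun (s : ℤ) r => (c : ℂ) * displacedValue γ δ φ (alphaD d * (d * s + j)) r)
    (fun (s : ℤ) r => 1 / (1 + (alphaD d * (d * s + j)) ^ 2) * (c * W r)) hmeas
    (fun s => ae_of_all _ (hbound s)) (ae_of_all _ fun r => hw.mul_right _)
    (by simp only [tsum_mul_right]; exact (hWi.const_mul c).const_mul _) (ae_of_all _ hF)
  refine hI.unique
    ((congrArg (HasSum · _) (funext fun s => ?_)).mpr (lp_apply_hasSum hΨ φ))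
  rw [integral_const_mul, integral_displacedValue hγ hδ, Lp.toTemperedDistribution_apply,
    ← integral_const_mul]
  refine integral_congr_ae ?_
  have hν : 0 < √(δ ^ 2 / lam γ δ) := by positivity
  have hpos : 0 < √(2 * √(Real.pi * √(δ ^ 2 / lam γ δ) ^ 2)) := by positivity
  have hx : (s + (j : ℝ) / d) * (alphaD d * d * (1 - γ ^ 2 * δ ^ 2 / (2 * lam γ δ))) =
      alphaD d * (d * s + j) * (1 - γ ^ 2 * δ ^ 2 / (2 * lam γ δ)) := by
    field_simp
  rw [hx]
  filter_upwards [packet_ae_eq hν (alphaD d * (d * s + j) *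
      (1 - γ ^ 2 * δ ^ 2 / (2 * lam γ δ))), Lp.coeFn_smul (((c / √(lam γ δ) /
      √(2 * √(Real.pi * √(δ ^ 2 / lam γ δ) ^ 2)) : ℝ) : ℂ)) (((Real.exp (-((alphaD d * (d * s + j) *
        (1 - γ ^ 2 * δ ^ 2 / (2 * lam γ δ))) ^ 2 /
        (2 * (lam γ δ / γ ^ 2 * (1 - γ ^ 2 * δ ^ 2 / (2 * lam γ δ)) ^ 2)))) : ℝ) : ℂ) •
      packet (√(δ ^ 2 / lam γ δ))
        (alphaD d * (d * s + j) * (1 - γ ^ 2 * δ ^ 2 / (2 * lam γ δ)))),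
    Lp.coeFn_smul ((Real.exp (-((alphaD d * (d * s + j) *
        (1 - γ ^ 2 * δ ^ 2 / (2 * lam γ δ))) ^ 2 /
        (2 * (lam γ δ / γ ^ 2 * (1 - γ ^ 2 * δ ^ 2 / (2 * lam γ δ)) ^ 2)))) : ℝ) : ℂ)
      (packet (√(δ ^ 2 / lam γ δ))
        (alphaD d * (d * s + j) * (1 - γ ^ 2 * δ ^ 2 / (2 * lam γ δ))))] with y h1 h2 h3
  rw [h2, Pi.smul_apply, h3, Pi.smul_apply, h1, displacement_kernel_eq hγ hδ hρ,
    Real.sq_sqrt (by positivity)]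
  simp only [smul_eq_mul]
  rw [Real.sq_sqrt (by positivity)] at hpos
  have hpos' : ((√(2 * √(Real.pi * (δ ^ 2 / lam γ δ))) : ℝ) : ℂ) ≠ 0 := by
    exact_mod_cast hpos.ne'
  rw [Complex.ofReal_div, Complex.ofReal_div, Complex.ofReal_mul, Complex.ofReal_mul,
    Complex.ofReal_mul, Complex.ofReal_div, Complex.ofReal_one]
  generalize ((√(2 * √(Real.pi * (δ ^ 2 / lam γ δ))) : ℝ) : ℂ) = S at hpos' ⊢
  field_simp

/-! ### Fourier representation of the Fock states -/

/-- The integrand of the Fourier representation of the `n`-th derivative of a Gaussian. -/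
noncomputable def hermiteKernel (n : ℕ) (x ξ : ℝ) : ℂ :=
  (-Complex.I * ξ) ^ n * Complex.exp (-((1 / 2 : ℝ) : ℂ) * ξ ^ 2 + Complex.I * x * ξ + 0)

/-- `(-1)ⁿ` times the `n`-th derivative of `exp(-x²/2)`, as a Fourier integral. -/
noncomputable def hermiteGauss (n : ℕ) (x : ℝ) : ℂ :=
  ((1 / √(2 * Real.pi) : ℝ) : ℂ) * ∫ ξ : ℝ, hermiteKernel n x ξ

theorem norm_hermiteKernel (n : ℕ) (x ξ : ℝ) :
    ‖hermiteKernel n x ξ‖ = |ξ| ^ n * Real.exp (-(1 / 2) * ξ ^ 2) := by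
  rw [hermiteKernel, norm_mul, norm_pow, norm_mul, norm_neg, Complex.norm_I, one_mul,
    Complex.norm_real, Real.norm_eq_abs, Complex.norm_exp]
  congr 2
  rw [show (-((1 / 2 : ℝ) : ℂ) * ξ ^ 2 + Complex.I * x * ξ + 0) =
    ((-(1 / 2) * ξ ^ 2 : ℝ) : ℂ) + ((x * ξ : ℝ) : ℂ) * Complex.I by push_cast; ring]
  simp only [Complex.add_re, Complex.ofReal_re, Complex.re_ofReal_mul, Complex.I_re]
  ring

theorem continuous_hermiteKernel (n : ℕ) (x : ℝ) : Continuous (hermiteKernel n x) := by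
  unfold hermiteKernel; fun_prop

theorem integrable_abs_pow_mul_exp (n : ℕ) :
    Integrable (fun ξ : ℝ => |ξ| ^ n * Real.exp (-(1 / 2) * ξ ^ 2)) := by
  have h := (integrable_rpow_mul_exp_neg_mul_sq (b := 1 / 2) (by norm_num) (s := n)
    (by have : (0 : ℝ) ≤ n := n.cast_nonneg
        linarith)).norm
  refine h.congr (ae_of_all _ fun ξ => ?_)
  simp only [norm_mul, Real.norm_eq_abs, Real.rpow_natCast, abs_pow, Real.abs_exp]

theorem integrable_hermiteKernel (n : ℕ) (x : ℝ) : Integrable (hermiteKernel n x) :=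
  (integrable_abs_pow_mul_exp n).mono' (continuous_hermiteKernel n x).aestronglyMeasurable
    (ae_of_all _ fun ξ => (norm_hermiteKernel n x ξ).le)

/-- Differentiation under the integral brings down `iξ = -(-iξ)`, which raises the index and changes
the sign; the dominating function does not depend on `x`. -/
theorem hasDerivAt_hermiteGauss (n : ℕ) (x : ℝ) :
    HasDerivAt (hermiteGauss n) (-hermiteGauss (n + 1) x) x := by
  have h := (hasDerivAt_integral_of_dominated_loc_of_deriv_le (μ := (volume : Measure ℝ))
    (F := fun x ξ => hermiteKernel n x ξ) (F' := fun x ξ => -hermiteKernel (n + 1) x ξ)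
    (x₀ := x) (s := Set.univ) (bound := fun ξ => |ξ| ^ (n + 1) * Real.exp (-(1 / 2) * ξ ^ 2))
    Filter.univ_mem
    (Filter.Eventually.of_forall fun y => (continuous_hermiteKernel n y).aestronglyMeasurable)
    (integrable_hermiteKernel n x)
    (continuous_hermiteKernel (n + 1) x).neg.aestronglyMeasurable
    (ae_of_all _ fun ξ y _ => by rw [norm_neg, norm_hermiteKernel])
    (integrable_abs_pow_mul_exp (n + 1))
    (ae_of_all _ fun ξ y _ => ?_)).2
  · have h2 := h.const_mul ((1 / √(2 * Real.pi) : ℝ) : ℂ)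
    rw [integral_neg] at h2
    exact h2.congr_deriv (by rw [hermiteGauss]; ring)
  · have h1 : HasDerivAt (fun y : ℝ => -((1 / 2 : ℝ) : ℂ) * (ξ : ℂ) ^ 2 + Complex.I * y * ξ + 0)
        (Complex.I * ξ) y := by
      simpa using ((((Complex.ofRealCLM.hasDerivAt (x := y)).const_mul Complex.I).mul_const
        (ξ : ℂ)).const_add (-((1 / 2 : ℝ) : ℂ) * (ξ : ℂ) ^ 2)).add_const 0
    refine (h1.cexp.const_mul ((-Complex.I * (ξ : ℂ)) ^ n)).congr_deriv ?_
    rw [hermiteKernel, pow_succ]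
    ring

theorem hermiteGauss_zero (x : ℝ) :
    hermiteGauss 0 x = ((Real.exp (-(x ^ 2 / 2)) : ℝ) : ℂ) := by
  simp only [hermiteGauss, hermiteKernel, pow_zero, one_mul]
  rw [integral_cexp_neg_quadratic (by norm_num), ← mul_assoc, ← Complex.ofReal_mul,
    show Real.pi / (1 / 2) = 2 * Real.pi by ring, one_div_mul_cancel (by positivity),
    Complex.ofReal_one, one_mul, Complex.ofReal_exp]
  congr 1
  push_cast
  linear_combination ((x : ℂ) ^ 2 / 2) * Complex.I_sq

/-- Conjugating the kernel amounts to `ξ ↦ -ξ`. Reality of the Fock states removes the conjugate in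
`bracket`. -/
theorem conj_hermiteGauss (n : ℕ) (x : ℝ) :
    (starRingEnd ℂ) (hermiteGauss n x) = hermiteGauss n x := by
  rw [hermiteGauss, map_mul, Complex.conj_ofReal, ← integral_conj,
    ← integral_neg_eq_self (hermiteKernel n x)]
  congr 2
  funext ξ
  simp only [hermiteKernel, map_mul, map_pow, ← Complex.exp_conj, map_add, map_neg,
    Complex.conj_I, Complex.conj_ofReal, map_zero]
  push_cast
  congr 2 <;> ring

/-- On functions `exp(x²/2) g`, the creation operator acts as `g ↦ -g'/√2`; the argument `√2 x`
cancels the factor `1/√2`. -/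
theorem creation_pow_vacuum_apply (n : ℕ) (x : ℝ) : (creation ^ n) vacuum x =
    ((Real.pi ^ (-(1 / 4 : ℝ)) * Real.exp (x ^ 2 / 2) : ℝ) : ℂ) * hermiteGauss n (√2 * x) := by
  induction n generalizing x with
  | zero =>
    rw [hermiteGauss_zero, ← Complex.ofReal_mul, pow_zero]
    change vacuum x = _
    rw [vacuum_apply, mul_assoc, ← Real.exp_add, mul_pow, Real.sq_sqrt (by norm_num)]
    congr 3
    ring
  | succ n ih =>
    have h1 : (creation ^ (n + 1)) vacuum = creation ((creation ^ n) vacuum) := by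
      rw [pow_succ']; rfl
    have h2 : ((creation ^ n) vacuum : ℝ → ℂ) = fun y : ℝ =>
        ((Real.pi ^ (-(1 / 4 : ℝ)) * Real.exp (y ^ 2 / 2) : ℝ) : ℂ) *
          hermiteGauss n (√2 * y) := funext ih
    have e1 : HasDerivAt (fun y : ℝ =>
        ((Real.pi ^ (-(1 / 4 : ℝ)) * Real.exp (y ^ 2 / 2) : ℝ) : ℂ))
        ((Real.pi ^ (-(1 / 4 : ℝ)) * (Real.exp (x ^ 2 / 2) * x) : ℝ) : ℂ) x := by
      refine HasDerivAt.ofReal_comp (HasDerivAt.const_mul _ (HasDerivAt.exp ?_))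
      exact ((hasDerivAt_pow 2 x).div_const 2).congr_deriv (by norm_num)
    have e2 : HasDerivAt (fun y : ℝ => hermiteGauss n (√2 * y))
        ((√2 : ℝ) • (-hermiteGauss (n + 1) (√2 * x))) x := by
      have := (hasDerivAt_hermiteGauss n (√2 * x)).scomp x ((hasDerivAt_id x).const_mul √2)
      simpa [Function.comp_def] using this
    rw [h1, creation_apply, h2, (e1.fun_mul e2).deriv]
    have hs : ((1 / √2 : ℝ) : ℂ) * ((√2 : ℝ) : ℂ) = 1 := by
      rw [← Complex.ofReal_mul, one_div_mul_cancel (by positivity), Complex.ofReal_one]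
    rw [Complex.real_smul]
    push_cast at hs ⊢
    linear_combination (((Real.pi ^ (-(1 / 4 : ℝ)) : ℝ) : ℂ) * Complex.exp (x ^ 2 / 2) *
      hermiteGauss (n + 1) (√2 * x)) * hs

theorem fock_apply (n : ℕ) (x : ℝ) : fock n x =
    ((1 / √(n.factorial : ℝ) * (Real.pi ^ (-(1 / 4 : ℝ)) * Real.exp (x ^ 2 / 2)) : ℝ) : ℂ) *
      hermiteGauss n (√2 * x) := by
  rw [fock, smul_apply, creation_pow_vacuum_apply, smul_eq_mul, ← mul_assoc,
    Complex.ofReal_mul (1 / _)]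

theorem conj_fock_apply (n : ℕ) (x : ℝ) : (starRingEnd ℂ) (fock n x) = fock n x := by
  rw [fock_apply, map_mul, Complex.conj_ofReal, conj_hermiteGauss]

theorem conjS_fock (n : ℕ) : conjS (fock n) = fock n := by
  ext x
  exact conj_fock_apply n x

/-! ### The Mehler formula -/

/-- From `2|ξ||η| ≤ ξ² + η²`. For `r < 1` a Gaussian of rate `(1 - r)/2` remains, which dominates
both the Mehler integral and its power series. -/
theorem exp_mul_gaussians_le {r : ℝ} (hr : 0 ≤ r) (ξ η : ℝ) :
    Real.exp (r * |ξ| * |η|) * (Real.exp (-(1 / 2) * ξ ^ 2) * Real.exp (-(1 / 2) * η ^ 2)) ≤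
      Real.exp (-((1 - r) / 2) * ξ ^ 2) * Real.exp (-((1 - r) / 2) * η ^ 2) := by
  rw [← Real.exp_add, ← Real.exp_add, ← Real.exp_add, Real.exp_le_exp]
  nlinarith [mul_nonneg hr (sq_nonneg (|ξ| - |η|)), sq_abs ξ, sq_abs η]

theorem integrable_gaussian_prod {b : ℝ} (hb : 0 < b) :
    Integrable (fun z : ℝ × ℝ => Real.exp (-b * z.1 ^ 2) * Real.exp (-b * z.2 ^ 2)) :=
  (integrable_exp_neg_mul_sq hb).mul_prod (integrable_exp_neg_mul_sq hb)

theorem norm_hermiteKernel_zero_mul (r X Y : ℝ) (z : ℝ × ℝ) :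
    ‖Complex.exp (-(r : ℂ) * z.1 * z.2) * (hermiteKernel 0 X z.1 * hermiteKernel 0 Y z.2)‖ =
      Real.exp (-r * z.1 * z.2) *
        (Real.exp (-(1 / 2) * z.1 ^ 2) * Real.exp (-(1 / 2) * z.2 ^ 2)) := by
  rw [norm_mul, norm_mul, norm_hermiteKernel, norm_hermiteKernel, pow_zero, pow_zero, one_mul,
    one_mul, show -(r : ℂ) * z.1 * z.2 = ((-r * z.1 * z.2 : ℝ) : ℂ) by push_cast; ring,
    ← Complex.ofReal_exp, Complex.norm_real, Real.norm_of_nonneg (Real.exp_pos _).le]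

theorem integral_mehler {r : ℝ} (hr : 0 < r) (hr1 : r < 1) (X Y : ℝ) :
    ∫ z : ℝ × ℝ, Complex.exp (-(r : ℂ) * z.1 * z.2) *
        (hermiteKernel 0 X z.1 * hermiteKernel 0 Y z.2) =
      ((2 * Real.pi / √(1 - r ^ 2) *
        Real.exp (-((X ^ 2 - 2 * r * X * Y + Y ^ 2) / (2 * (1 - r ^ 2)))) : ℝ) : ℂ) := by
  have hr2 : 0 < 1 - r ^ 2 := by nlinarith
  have hint : Integrable (fun z : ℝ × ℝ => Complex.exp (-(r : ℂ) * z.1 * z.2) *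
      (hermiteKernel 0 X z.1 * hermiteKernel 0 Y z.2)) := by
    refine (integrable_gaussian_prod (b := (1 - r) / 2) (by linarith)).mono' ?_
      (ae_of_all _ fun z => ?_)
    · have h1 := continuous_hermiteKernel 0 X
      have h2 := continuous_hermiteKernel 0 Y
      exact Continuous.aestronglyMeasurable (by fun_prop)
    · rw [norm_hermiteKernel_zero_mul]
      refine le_trans ?_ (exp_mul_gaussians_le hr.le z.1 z.2)
      refine mul_le_mul_of_nonneg_right (Real.exp_le_exp.2 ?_) (by positivity)
      rw [mul_assoc, mul_assoc, neg_mul, ← mul_neg, ← abs_mul]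
      exact mul_le_mul_of_nonneg_left (neg_le_abs _) hr.le
  rw [Measure.volume_eq_prod, integral_prod _ hint]
  -- Integrating out `η` adds `r²ξ²/2` to the exponent, so the remaining Gaussian in `ξ` has rate
  -- `(1 - r²)/2 > 0`.
  have hinner : ∀ ξ : ℝ, ∫ η : ℝ, Complex.exp (-(r : ℂ) * ξ * η) *
      (hermiteKernel 0 X ξ * hermiteKernel 0 Y η) = ((√(2 * Real.pi) : ℝ) : ℂ) *
      Complex.exp (-(((1 - r ^ 2) / 2 : ℝ) : ℂ) * ξ ^ 2 + (Complex.I * (X - r * Y)) * ξ +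
        -((Y : ℂ) ^ 2 / 2)) := fun ξ => by
    have h : ∀ η : ℝ, Complex.exp (-(r : ℂ) * ξ * η) *
        (hermiteKernel 0 X ξ * hermiteKernel 0 Y η) =
        Complex.exp (-((1 / 2 : ℝ) : ℂ) * η ^ 2 + (Complex.I * Y - r * ξ) * η +
          (-((1 / 2 : ℝ) : ℂ) * ξ ^ 2 + Complex.I * X * ξ)) := fun η => by
      simp only [hermiteKernel, pow_zero, one_mul]
      rw [← Complex.exp_add, ← Complex.exp_add]
      congr 1
      ring
    simp only [h]
    rw [integral_cexp_neg_quadratic (by norm_num), show Real.pi / (1 / 2) = 2 * Real.pi by ring]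
    congr 2
    push_cast
    linear_combination ((Y : ℂ) ^ 2 / 2) * Complex.I_sq
  simp only [hinner]
  rw [integral_const_mul, integral_cexp_neg_quadratic (by linarith), ← mul_assoc,
    ← Complex.ofReal_mul, Complex.ofReal_mul _ (Real.exp _), Complex.ofReal_exp]
  congr 1
  · rw [← Real.sqrt_mul (by positivity), eq_comm,
      show 2 * Real.pi * (Real.pi / ((1 - r ^ 2) / 2)) = (2 * Real.pi) ^ 2 / (1 - r ^ 2) by
        field_simp, Real.sqrt_div (by positivity), Real.sqrt_sq (by positivity)]
  · congr 1
    have h0 : (1 - (r : ℂ) ^ 2) ≠ 0 := by exact_mod_cast hr2.ne'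
    push_cast
    field_simp
    rw [Complex.I_sq]
    ring

/-- Since `(-iξ)ⁿ(-iη)ⁿ = (-ξη)ⁿ`, the sum under the double Fourier integral is the exponential
series of `-rξη`. -/
theorem hasSum_hermiteGauss_mul {r : ℝ} (hr : 0 < r) (hr1 : r < 1) (X Y : ℝ) :
    HasSum (fun n : ℕ => ((r ^ n / n.factorial : ℝ) : ℂ) *
        (hermiteGauss n X * hermiteGauss n Y))
      ((1 / √(1 - r ^ 2) *
        Real.exp (-((X ^ 2 - 2 * r * X * Y + Y ^ 2) / (2 * (1 - r ^ 2)))) : ℝ) : ℂ) := by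
  have hterm : ∀ (n : ℕ) (z : ℝ × ℝ),
      ((r ^ n / n.factorial : ℝ) : ℂ) * (hermiteKernel n X z.1 * hermiteKernel n Y z.2) =
      (-(r : ℂ) * z.1 * z.2) ^ n / n.factorial *
        (hermiteKernel 0 X z.1 * hermiteKernel 0 Y z.2) := fun n z => by
    simp only [hermiteKernel, pow_zero, one_mul]
    have : (-(r : ℂ) * z.1 * z.2) ^ n =
        (r : ℂ) ^ n * ((-Complex.I * z.1) ^ n * (-Complex.I * z.2) ^ n) := by
      rw [← mul_pow, ← mul_pow]
      congr 1
      linear_combination (-(r : ℂ) * z.1 * z.2) * Complex.I_sq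
    rw [this]
    push_cast
    ring
  have hexp : ∀ z : ℝ × ℝ, HasSum (fun n : ℕ => (r * |z.1| * |z.2|) ^ n / n.factorial)
      (Real.exp (r * |z.1| * |z.2|)) := fun z => by
    rw [Real.exp_eq_exp_ℝ]
    exact NormedSpace.expSeries_div_hasSum_exp _
  have key := hasSum_integral_of_dominated_convergence (μ := (volume : Measure (ℝ × ℝ)))
    (F := fun (n : ℕ) z =>
      ((r ^ n / n.factorial : ℝ) : ℂ) * (hermiteKernel n X z.1 * hermiteKernel n Y z.2))
    (f := fun z => Complex.exp (-(r : ℂ) * z.1 * z.2) *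
      (hermiteKernel 0 X z.1 * hermiteKernel 0 Y z.2))
    (fun n z => (r * |z.1| * |z.2|) ^ n / n.factorial *
      (Real.exp (-(1 / 2) * z.1 ^ 2) * Real.exp (-(1 / 2) * z.2 ^ 2)))
    (fun n => by
      have h1 := continuous_hermiteKernel n X
      have h2 := continuous_hermiteKernel n Y
      exact Continuous.aestronglyMeasurable (by fun_prop))
    (fun n => ae_of_all _ fun z => by
      rw [norm_mul, norm_mul, norm_hermiteKernel, norm_hermiteKernel, Complex.norm_real,
        Real.norm_of_nonneg (by positivity), mul_pow, mul_pow]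
      exact le_of_eq (by ring))
    (ae_of_all _ fun z => (hexp z).summable.mul_right _)
    (by
      simp only [fun z : ℝ × ℝ => ((hexp z).mul_right
        (Real.exp (-(1 / 2) * z.1 ^ 2) * Real.exp (-(1 / 2) * z.2 ^ 2))).tsum_eq]
      refine (integrable_gaussian_prod (b := (1 - r) / 2) (by linarith)).mono'
        (Continuous.aestronglyMeasurable (by fun_prop)) (ae_of_all _ fun z => ?_)
      rw [Real.norm_of_nonneg (by positivity)]
      exact exp_mul_gaussians_le hr.le z.1 z.2)
    (ae_of_all _ fun z => by
      simp only [hterm]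
      refine HasSum.mul_right _ ?_
      rw [Complex.exp_eq_exp_ℂ]
      exact NormedSpace.expSeries_div_hasSum_exp _)
  rw [integral_mehler hr hr1] at key
  have key2 := key.mul_left ((1 / (2 * Real.pi) : ℝ) : ℂ)
  rw [← Complex.ofReal_mul] at key2
  have hc : 1 / (2 * Real.pi) * (2 * Real.pi / √(1 - r ^ 2) *
      Real.exp (-((X ^ 2 - 2 * r * X * Y + Y ^ 2) / (2 * (1 - r ^ 2))))) =
      1 / √(1 - r ^ 2) *
        Real.exp (-((X ^ 2 - 2 * r * X * Y + Y ^ 2) / (2 * (1 - r ^ 2)))) := by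
    field_simp
  rw [hc] at key2
  refine (congrArg (HasSum · _) (funext fun n => ?_)).mpr key2
  have hp : ((1 / √(2 * Real.pi) : ℝ) : ℂ) * ((1 / √(2 * Real.pi) : ℝ) : ℂ) =
      ((1 / (2 * Real.pi) : ℝ) : ℂ) := by
    rw [← Complex.ofReal_mul, div_mul_div_comm, one_mul, Real.mul_self_sqrt (by positivity)]
  rw [integral_const_mul, Measure.volume_eq_prod,
    integral_prod_mul (hermiteKernel n X) (hermiteKernel n Y), hermiteGauss, hermiteGauss, ← hp]
  ring

/-- The Mehler kernel, the position representation of `exp(-β (n̂ + 1/2))`. -/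
noncomputable def mehler (β x y : ℝ) : ℝ :=
  1 / √(2 * Real.pi * Real.sinh β) *
    Real.exp (-(Real.cosh β * (x ^ 2 + y ^ 2) - 2 * x * y) / (2 * Real.sinh β))

/-- The preceding series at `r = exp(-β)`, `X = √2 x`, `Y = √2 y`; `sinh β` and `cosh β` are
rational in `r`. -/
theorem hasSum_mehler {β : ℝ} (hβ : 0 < β) (x y : ℝ) :
    HasSum (fun n : ℕ => ((Real.exp (-β * (n + 1 / 2)) : ℝ) : ℂ) * (fock n x * fock n y))
      ((mehler β x y : ℝ) : ℂ) := by
  have hr1 : Real.exp (-β) < 1 := Real.exp_lt_one_iff.2 (by linarith)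
  have hr0 := Real.exp_pos (-β)
  have h := (hasSum_hermiteGauss_mul hr0 hr1 (√2 * x) (√2 * y)).mul_left
    ((Real.exp (-β / 2) * (Real.pi ^ (-(1 / 4 : ℝ)) * Real.exp (x ^ 2 / 2)) *
      (Real.pi ^ (-(1 / 4 : ℝ)) * Real.exp (y ^ 2 / 2)) : ℝ) : ℂ)
  rw [← Complex.ofReal_mul] at h
  have hval : Real.exp (-β / 2) * (Real.pi ^ (-(1 / 4 : ℝ)) * Real.exp (x ^ 2 / 2)) *
      (Real.pi ^ (-(1 / 4 : ℝ)) * Real.exp (y ^ 2 / 2)) * (1 / √(1 - Real.exp (-β) ^ 2) *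
        Real.exp (-(((√2 * x) ^ 2 - 2 * Real.exp (-β) * (√2 * x) * (√2 * y) + (√2 * y) ^ 2) /
          (2 * (1 - Real.exp (-β) ^ 2))))) = mehler β x y := by
    set r := Real.exp (-β) with hr
    have hr2 : 0 < 1 - r ^ 2 := by nlinarith
    have hsinh : Real.sinh β = (1 - r ^ 2) / (2 * r) := by
      rw [Real.sinh_eq, ← hr, show Real.exp β = r⁻¹ by rw [hr, Real.exp_neg, inv_inv]]
      field_simp
    have hcosh : Real.cosh β = (1 + r ^ 2) / (2 * r) := by
      rw [Real.cosh_eq, ← hr, show Real.exp β = r⁻¹ by rw [hr, Real.exp_neg, inv_inv]]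
      field_simp
    have h3 : Real.pi ^ (-(1 / 4 : ℝ)) * Real.pi ^ (-(1 / 4 : ℝ)) = 1 / √Real.pi := by
      rw [← Real.rpow_add Real.pi_pos, Real.sqrt_eq_rpow,
        show -(1 / 4 : ℝ) + -(1 / 4) = -(1 / 2) by norm_num, Real.rpow_neg Real.pi_pos.le,
        inv_eq_one_div]
    have h4 : Real.exp (-β / 2) = √r := by rw [hr, Real.exp_half]
    have h5 : √r * (1 / √Real.pi) * (1 / √(1 - r ^ 2)) =
        1 / √(2 * Real.pi * Real.sinh β) := by
      rw [hsinh, one_div, one_div, one_div, ← Real.sqrt_inv, ← Real.sqrt_inv, ← Real.sqrt_inv,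
        ← Real.sqrt_mul (by positivity), ← Real.sqrt_mul (by positivity)]
      congr 1
      field_simp
    have h6 : Real.exp (x ^ 2 / 2) * Real.exp (y ^ 2 / 2) *
        Real.exp (-(((√2 * x) ^ 2 - 2 * r * (√2 * x) * (√2 * y) + (√2 * y) ^ 2) /
          (2 * (1 - r ^ 2)))) =
        Real.exp (-(Real.cosh β * (x ^ 2 + y ^ 2) - 2 * x * y) / (2 * Real.sinh β)) := by
      rw [← Real.exp_add, ← Real.exp_add]
      congr 1
      have h2 : √2 ^ 2 = (2 : ℝ) := Real.sq_sqrt (by norm_num)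
      have e : (√2 * x) ^ 2 - 2 * r * (√2 * x) * (√2 * y) + (√2 * y) ^ 2 =
          2 * (x ^ 2 - 2 * r * x * y + y ^ 2) := by
        linear_combination (x ^ 2 - 2 * r * x * y + y ^ 2) * h2
      rw [e, hsinh, hcosh]
      field_simp
      ring
    rw [mehler, ← h5, ← h6, ← h3, h4]
    ring
  rw [hval] at h
  refine (congrArg (HasSum · _) (funext fun n => ?_)).mpr h
  have h7 : Real.exp (-β * (n + 1 / 2)) = Real.exp (-β / 2) * Real.exp (-β) ^ n := by
    rw [← Real.exp_nat_mul, ← Real.exp_add]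
    congr 1
    ring
  have h8 : 1 / √(n.factorial : ℝ) * (1 / √(n.factorial : ℝ)) = 1 / n.factorial := by
    rw [div_mul_div_comm, one_mul, Real.mul_self_sqrt (by positivity)]
  have h9 : Real.exp (-β * (n + 1 / 2)) *
      ((1 / √(n.factorial : ℝ) * (Real.pi ^ (-(1 / 4 : ℝ)) * Real.exp (x ^ 2 / 2))) *
      (1 / √(n.factorial : ℝ) * (Real.pi ^ (-(1 / 4 : ℝ)) * Real.exp (y ^ 2 / 2)))) =
      Real.exp (-β / 2) * (Real.pi ^ (-(1 / 4 : ℝ)) * Real.exp (x ^ 2 / 2)) *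
      (Real.pi ^ (-(1 / 4 : ℝ)) * Real.exp (y ^ 2 / 2)) * (Real.exp (-β) ^ n / n.factorial) := by
    rw [h7, div_eq_mul_one_div (Real.exp (-β) ^ n), ← h8]
    ring
  have h10 := congrArg (fun t : ℝ => (t : ℂ)) h9
  rw [Complex.ofReal_mul (Real.exp (-β * (n + 1 / 2))),
    Complex.ofReal_mul (1 / √(n.factorial : ℝ) * (Real.pi ^ (-(1 / 4 : ℝ)) * Real.exp (x ^ 2 / 2))),
    Complex.ofReal_mul _ (Real.exp (-β) ^ n / n.factorial)] at h10
  rw [fock_apply, fock_apply]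
  linear_combination (hermiteGauss n (√2 * x) * hermiteGauss n (√2 * y)) * h10

/-! ### Growth of the Fock states and the damped ideal state -/

theorem mehler_diag {β : ℝ} (x : ℝ) : mehler β x x = 1 / √(2 * Real.pi * Real.sinh β) *
    Real.exp (-((Real.cosh β - 1) / Real.sinh β * x ^ 2)) := by
  rw [mehler]
  congr 2
  -- When `sinh β = 0` both exponents are `0` by the convention for division by zero.
  by_cases h : Real.sinh β = 0
  · simp [h]
  · field_simp
    ring

/-- On the diagonal the Mehler series has nonnegative terms, so each is at most the kernel, a
Gaussian in `x`. The parameter `2β` becomes `β` on taking square roots; since `β` is arbitrary, the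
growth in `n` can be made slower than any given damping. -/
theorem fock_bound {β : ℝ} (hβ : 0 < β) : ∃ C k : ℝ, 0 < C ∧ 0 < k ∧ ∀ (n : ℕ) (x : ℝ),
    ‖fock n x‖ ≤ C * Real.exp (β * n) * Real.exp (-(k * x ^ 2)) := by
  have hs : 0 < Real.sinh (2 * β) := Real.sinh_pos_iff.2 (by linarith)
  have hc : 1 < Real.cosh (2 * β) := Real.one_lt_cosh.2 (by linarith)
  set k := (Real.cosh (2 * β) - 1) / Real.sinh (2 * β) with hk
  have hk0 : 0 < k := div_pos (by linarith) hs
  set A := 1 / √(2 * Real.pi * Real.sinh (2 * β)) with hA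
  have hA0 : 0 < A := by positivity
  refine ⟨√A * Real.exp (β / 2), k / 2, by positivity, by positivity, fun n x => ?_⟩
  have h2 : HasSum (fun n : ℕ => Real.exp (-(2 * β) * (n + 1 / 2)) * ‖fock n x‖ ^ 2)
      (mehler (2 * β) x x) := by
    rw [← Complex.hasSum_ofReal]
    have h3 := hasSum_mehler (β := 2 * β) (by linarith) x x
    refine (congrArg (HasSum · _) (funext fun m => ?_)).mpr h3
    have h1m : ((‖fock m x‖ ^ 2 : ℝ) : ℂ) = fock m x * fock m x := by
      nth_rw 3 [← conj_fock_apply]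
      rw [Complex.mul_conj, Complex.normSq_eq_norm_sq]
    rw [Complex.ofReal_mul, h1m]
  have h3 : Real.exp (-(2 * β) * (n + 1 / 2)) * ‖fock n x‖ ^ 2 ≤ A * Real.exp (-(k * x ^ 2)) := by
    have := h2.summable.le_tsum n (fun m _ => by positivity)
    rwa [h2.tsum_eq, mehler_diag] at this
  refine abs_le_of_sq_le_sq' ?_ (by positivity) |>.2
  have h4 : Real.exp (-(2 * β) * (n + 1 / 2)) * Real.exp (2 * β * (n + 1 / 2)) = 1 := by
    rw [← Real.exp_add, ← Real.exp_zero]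
    congr 1
    ring
  have h5 : (√A * Real.exp (β / 2) * Real.exp (β * n) * Real.exp (-(k / 2 * x ^ 2))) ^ 2 =
      A * Real.exp (-(k * x ^ 2)) * Real.exp (2 * β * (n + 1 / 2)) := by
    rw [mul_pow, mul_pow, mul_pow, Real.sq_sqrt hA0.le, ← Real.exp_nat_mul, ← Real.exp_nat_mul,
      ← Real.exp_nat_mul, mul_assoc, mul_assoc, mul_assoc, ← Real.exp_add, ← Real.exp_add,
      ← Real.exp_add]
    congr 2
    push_cast
    ring
  rw [h5]
  calc ‖fock n x‖ ^ 2 = Real.exp (-(2 * β) * (n + 1 / 2)) * ‖fock n x‖ ^ 2 *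
        Real.exp (2 * β * (n + 1 / 2)) := by rw [mul_right_comm, h4, one_mul]
    _ ≤ _ := mul_le_mul_of_nonneg_right h3 (Real.exp_pos _).le

theorem norm_toLp_fock_bound {β : ℝ} (hβ : 0 < β) : ∃ D : ℝ, ∀ n : ℕ,
    ‖(fock n).toLp 2 volume‖ ≤ D * Real.exp (β * n) := by
  obtain ⟨C, k, hC, hk, h⟩ := fock_bound hβ
  -- With this width the packet is `B exp(-k x²)`, so its norm controls that of every function under
  -- the Gaussian bound.
  set w := √(1 / (2 * k)) with hw
  have hw0 : 0 < w := by positivity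
  set B := √(2 * √(Real.pi * w ^ 2)) * (1 / √(2 * Real.pi * w ^ 2)) with hB
  have hB0 : 0 < B := by positivity
  refine ⟨C / B * ‖packet w 0‖, fun n => ?_⟩
  have h1 : ‖(fock n).toLp 2 volume‖ ≤ (C / B * Real.exp (β * n)) * ‖packet w 0‖ := by
    refine Lp.norm_le_mul_norm_of_ae_le_mul ?_
    filter_upwards [SchwartzMap.coeFn_toLp (fock n) 2 volume, packet_ae_eq hw0 0] with x hx1 hx2
    rw [hx1, hx2, Complex.norm_real, sub_zero, gauss, ← mul_assoc, ← hB,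
      Real.norm_of_nonneg (by positivity)]
    refine (h n x).trans (le_of_eq ?_)
    have he : x ^ 2 / (2 * w ^ 2) = k * x ^ 2 := by
      rw [hw, Real.sq_sqrt (by positivity)]
      field_simp
    rw [he]
    field_simp
  exact h1.trans (le_of_eq (by ring))

theorem hasSum_bracket_fock {d : ℕ} (hd : d ≠ 0) (j n : ℕ) :
    HasSum (fun s : ℤ => ((√(alphaD d * d) : ℝ) : ℂ) * fock n (alphaD d * (d * s + j)))
      (bracket (fock n) (ideal d j)) := by
  rw [bracket, conjS_fock]
  exact hasSum_ideal hd j (fock n)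

theorem summable_exp_lattice {d : ℕ} (hd : 0 < d) (j : ℕ) {k : ℝ} (hk : 0 < k) :
    Summable (fun s : ℤ => Real.exp (-(k * (alphaD d * (d * s + j)) ^ 2))) := by
  have hα := alphaD_pos hd
  have hd0 : (0 : ℝ) < d := by exact_mod_cast hd
  refine (summable_exp_comb (μ := 1 / (2 * k)) (Γ := alphaD d * d) (by positivity)
    (by positivity) (j / d)).congr fun s => ?_
  congr 2
  field_simp

theorem summable_exp_neg_mul_nat {β : ℝ} (hβ : 0 < β) :
    Summable (fun n : ℕ => Real.exp (-(β * n))) :=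
  (Real.summable_exp_nat_mul_iff.2 (neg_lt_zero.2 hβ)).congr fun n => by ring_nf

theorem summable_term3 {d : ℕ} (hd : 0 < d) (j : ℕ) {β : ℝ} (hβ : 0 < β) :
    Summable (term3 d j β) := by
  -- The bracket and the norm each grow like `exp(βn/4)`; against the damping `exp(-βn)` a factor
  -- `exp(-βn/2)` survives.
  obtain ⟨C, k, hC, hk, h⟩ := fock_bound (β := β / 4) (by linarith)
  obtain ⟨D, hD⟩ := norm_toLp_fock_bound (β := β / 4) (by linarith)
  have hS := summable_exp_lattice hd j hk
  set S := ∑' s : ℤ, Real.exp (-(k * (alphaD d * (d * s + j)) ^ 2)) with hSdef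
  have hS0 : 0 ≤ S := tsum_nonneg fun s => (Real.exp_pos _).le
  have hb : ∀ n : ℕ, ‖bracket (fock n) (ideal d j)‖ ≤
      √(alphaD d * d) * (C * Real.exp (β / 4 * n) * S) := fun n => by
    rw [← (hasSum_bracket_fock hd.ne' j n).tsum_eq]
    refine tsum_of_norm_bounded ((hS.hasSum.mul_left _).mul_left _) fun s => ?_
    rw [norm_mul, Complex.norm_real, Real.norm_of_nonneg (Real.sqrt_nonneg _)]
    exact mul_le_mul_of_nonneg_left (h n _) (Real.sqrt_nonneg _)
  refine Summable.of_norm_bounded ((summable_exp_neg_mul_nat (half_pos hβ)).mul_left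
    (Real.exp (-β / 2) * (√(alphaD d * d) * C * S * D))) fun n => ?_
  rw [term3, norm_smul, norm_mul, Complex.norm_real, Real.norm_of_nonneg (Real.exp_pos _).le]
  calc _ ≤ Real.exp (-β * (n + 1 / 2)) * (√(alphaD d * d) * (C * Real.exp (β / 4 * n) * S)) *
        (D * Real.exp (β / 4 * n)) :=
        mul_le_mul (mul_le_mul_of_nonneg_left (hb n) (Real.exp_pos _).le) (hD n)
          (norm_nonneg _) (by positivity)
    _ = Real.exp (-β * (n + 1 / 2)) * Real.exp (β / 4 * n) * Real.exp (β / 4 * n) *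
        (√(alphaD d * d) * C * S * D) := by ring
    _ = _ := by
      rw [← Real.exp_add, ← Real.exp_add, mul_right_comm (Real.exp (-β / 2)), ← Real.exp_add]
      congr 2
      ring

/-- Completing the square in `q`; the remainder reduces to `a² sinh β/(2 cosh β)` by `cosh² - sinh²
= 1`. -/
theorem mehler_eq_gauss {β : ℝ} (hβ : 0 < β) (a q : ℝ) : mehler β a q =
    1 / √(Real.cosh β) * (Real.exp (-((a / Real.cosh β) ^ 2 /
      (2 * (1 / (Real.sinh β * Real.cosh β))))) *
      gauss (Real.tanh β) (q - a / Real.cosh β)) := by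
  have hs : 0 < Real.sinh β := Real.sinh_pos_iff.2 hβ
  have hc : 0 < Real.cosh β := Real.cosh_pos β
  have h1 : 1 / √(2 * Real.pi * Real.sinh β) =
      1 / √(Real.cosh β) * (1 / √(2 * Real.pi * Real.tanh β)) := by
    rw [div_mul_div_comm, one_mul, ← Real.sqrt_mul hc.le, Real.tanh_eq_sinh_div_cosh]
    congr 2
    field_simp
  have h2 : Real.exp (-(Real.cosh β * (a ^ 2 + q ^ 2) - 2 * a * q) / (2 * Real.sinh β)) =
      Real.exp (-((a / Real.cosh β) ^ 2 / (2 * (1 / (Real.sinh β * Real.cosh β))))) *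
        Real.exp (-((q - a / Real.cosh β) ^ 2 / (2 * Real.tanh β))) := by
    rw [← Real.exp_add, Real.tanh_eq_sinh_div_cosh]
    congr 1
    field_simp
    linear_combination (-(a ^ 2)) * Real.cosh_sq β
  rw [mehler, gauss, h1, h2]
  ring

theorem summable_fock_lattice {d : ℕ} (hd : 0 < d) (j : ℕ) {β : ℝ} (hβ : 0 < β) (q : ℝ) :
    Summable (fun p : ℕ × ℤ => ((Real.exp (-β * (p.1 + 1 / 2)) : ℝ) : ℂ) *
      (((√(alphaD d * d) : ℝ) : ℂ) * fock p.1 (alphaD d * (d * p.2 + j))) * fock p.1 q) := by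
  obtain ⟨C, k, hC, hk, h⟩ := fock_bound (β := β / 4) (by linarith)
  refine Summable.of_norm_bounded ((((summable_exp_neg_mul_nat (half_pos hβ)).mul_of_nonneg
    (summable_exp_lattice hd j hk) (fun n => (Real.exp_pos _).le)
    (fun s => (Real.exp_pos _).le)).mul_left
    (Real.exp (-β / 2) * √(alphaD d * d) * C ^ 2 * Real.exp (-(k * q ^ 2))))) fun p => ?_
  rw [norm_mul, norm_mul, norm_mul, Complex.norm_real, Complex.norm_real,
    Real.norm_of_nonneg (Real.exp_pos _).le, Real.norm_of_nonneg (Real.sqrt_nonneg _)]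
  have e : Real.exp (-β * (p.1 + 1 / 2)) * Real.exp (β / 4 * p.1) * Real.exp (β / 4 * p.1) =
      Real.exp (-β / 2) * Real.exp (-(β / 2 * p.1)) := by
    rw [← Real.exp_add, ← Real.exp_add, ← Real.exp_add]
    congr 1
    ring
  calc _ ≤ Real.exp (-β * (p.1 + 1 / 2)) * (√(alphaD d * d) * (C * Real.exp (β / 4 * p.1) *
        Real.exp (-(k * (alphaD d * (d * p.2 + j)) ^ 2)))) *
        (C * Real.exp (β / 4 * p.1) * Real.exp (-(k * q ^ 2))) :=
        mul_le_mul (mul_le_mul_of_nonneg_left (mul_le_mul_of_nonneg_left (h _ _)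
          (Real.sqrt_nonneg _)) (Real.exp_pos _).le) (h _ _) (norm_nonneg _) (by positivity)
    _ = (Real.exp (-β * (p.1 + 1 / 2)) * Real.exp (β / 4 * p.1) * Real.exp (β / 4 * p.1)) *
        (√(alphaD d * d) * C ^ 2 * Real.exp (-(k * q ^ 2)) *
          Real.exp (-(k * (alphaD d * (d * p.2 + j)) ^ 2))) := by ring
    _ = _ := by rw [e]; ring

theorem hasSum_mehler_lattice {d : ℕ} (hd : 0 < d) (j : ℕ) {β : ℝ} (hβ : 0 < β) (q : ℝ) :
    HasSum (fun s : ℤ => ((√(alphaD d * d) : ℝ) : ℂ) *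
      ((mehler β (alphaD d * (d * s + j)) q : ℝ) : ℂ))
      ((√(alphaD d * d) / √(Real.cosh β) * conv (combE (1 / (Real.sinh β * Real.cosh β))
        (alphaD d * d / Real.cosh β) (j / d)) (gauss (Real.tanh β)) q : ℝ) : ℂ) := by
  have hs : 0 < Real.sinh β := Real.sinh_pos_iff.2 hβ
  have hc : 0 < Real.cosh β := Real.cosh_pos β
  have ht : 0 < Real.tanh β := by rw [Real.tanh_eq_sinh_div_cosh]; positivity
  have hα := alphaD_pos hd
  have hd0 : (0 : ℝ) < d := by exact_mod_cast hd
  have hΓ : alphaD d * d / Real.cosh β ≠ 0 := by positivity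
  have hμ : 0 < 1 / (Real.sinh β * Real.cosh β) := by positivity
  refine (congrArg (HasSum · _) (funext fun s => ?_)).mpr
    (Complex.hasSum_ofReal.2 ((hasSum_conv hμ ht hΓ (j / d) q).mul_left
      (√(alphaD d * d) / √(Real.cosh β))))
  rw [← Complex.ofReal_mul, mehler_eq_gauss hβ,
    show (s + (j : ℝ) / d) * (alphaD d * d / Real.cosh β) =
      alphaD d * (d * s + j) / Real.cosh β by field_simp]
  congr 1
  ring

/-- The double series over `(n, s)` converges absolutely. Summed over `s` first it gives the Fock
expansion, over `n` first the Mehler kernel at the lattice points. -/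
theorem hasSum_term3_apply {d : ℕ} (hd : 0 < d) (j : ℕ) {β : ℝ} (hβ : 0 < β) (q : ℝ) :
    HasSum (fun n : ℕ => ((Real.exp (-β * (n + 1 / 2)) : ℝ) : ℂ) *
        bracket (fock n) (ideal d j) * fock n q)
      ((√(alphaD d * d) / √(Real.cosh β) * conv (combE (1 / (Real.sinh β * Real.cosh β))
        (alphaD d * d / Real.cosh β) (j / d)) (gauss (Real.tanh β)) q : ℝ) : ℂ) := by
  obtain ⟨S, hS⟩ := summable_fock_lattice hd j hβ q
  have h1 := hS.prod_fiberwise fun n =>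
    ((hasSum_bracket_fock hd.ne' j n).mul_left
      ((Real.exp (-β * (n + 1 / 2)) : ℝ) : ℂ)).mul_right (fock n q)
  have h2 := ((Equiv.prodComm ℤ ℕ).hasSum_iff.2 hS).prod_fiberwise fun s =>
    (congrArg (HasSum · _) (funext fun n : ℕ => show _ =
      ((√(alphaD d * d) : ℝ) : ℂ) * (((Real.exp (-β * (n + 1 / 2)) : ℝ) : ℂ) *
        (fock n (alphaD d * (d * s + j)) * fock n q)) by
      simp only [Function.comp_apply, Equiv.prodComm_apply, Prod.swap_prod_mk]
      ring)).mpr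
      ((hasSum_mehler hβ (alphaD d * (d * s + j)) q).mul_left ((√(alphaD d * d) : ℝ) : ℂ))
  rw [← h2.unique (hasSum_mehler_lattice hd j hβ q)]
  exact h1

theorem unnormalized3_ae_eq {d : ℕ} (hd : 0 < d) (j : ℕ) {β : ℝ} (hβ : 0 < β) :
    unnormalized3 d j β =ᵐ[volume] fun q => ((√(alphaD d * d) / √(Real.cosh β) *
      conv (combE (1 / (Real.sinh β * Real.cosh β)) (alphaD d * d / Real.cosh β) (j / d))
        (gauss (Real.tanh β)) q : ℝ) : ℂ) := by
  refine ae_eq_of_hasSum (summable_term3 hd j hβ).hasSum (fun n => ?_)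
    (hasSum_term3_apply hd j hβ)
  filter_upwards [SchwartzMap.coeFn_toLp (fock n) 2 volume,
    Lp.coeFn_smul (((Real.exp (-β * (n + 1 / 2)) : ℝ) : ℂ) * bracket (fock n) (ideal d j))
      ((fock n).toLp 2 volume)] with q h1 h2
  rw [term3, h2, Pi.smul_apply, h1, smul_eq_mul]

/-! ### The three approximations -/

theorem term1_eq {d : ℕ} (hd : 0 < d) (j : ℕ) {κ : ℝ} (hκ : 0 < κ) (Δ : ℝ) (s : ℤ) :
    term1 d j κ Δ s = ((Real.exp (-(((s + (j : ℝ) / d) * (alphaD d * d)) ^ 2 /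
      (2 * (1 / κ ^ 2)))) : ℝ) : ℂ) • packet Δ ((s + j / d) * (alphaD d * d)) := by
  have hd0 : (0 : ℝ) < d := by exact_mod_cast hd
  rw [term1, packet, show (s + (j : ℝ) / d) * (alphaD d * d) = alphaD d * (d * s + j) by
    field_simp]
  congr 4
  field_simp

theorem approximation_comb {d : ℕ} (hd : 0 < d) (j : ℕ) {κ Δ : ℝ} (hκ : 0 < κ) (hΔ : 0 < Δ) :
    Summable (term1 d j κ Δ) ∧ unnormalized1 d j κ Δ =ᵐ[volume] fun q =>
      ((√(2 * √(Real.pi * Δ ^ 2)) *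
        conv (combE (1 / κ ^ 2) (alphaD d * d) (j / d)) (gauss (Δ ^ 2)) q : ℝ) : ℂ) := by
  have hd0 : (0 : ℝ) < d := by exact_mod_cast hd
  have hα := alphaD_pos hd
  have hΓ : alphaD d * d ≠ 0 := by positivity
  have hμ : 0 < 1 / κ ^ 2 := by positivity
  have ht := funext (term1_eq hd j hκ Δ)
  rw [unnormalized1, ht]
  exact ⟨summable_comb_packet hμ hΓ Δ _, tsum_comb_packet_ae_eq hμ hΓ hΔ _⟩

theorem approximation_displacement {d : ℕ} (hd : 0 < d) (j : ℕ) {γ δ : ℝ} (h : 0 < γ * δ)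
    (hρ : 0 < 1 - γ ^ 2 * δ ^ 2 / (2 * lam γ δ)) :
    HasKetIntegral (integrand2 d j γ δ) (unnormalized2 d j γ δ) ∧
    unnormalized2 d j γ δ =ᵐ[volume] fun q => ((√(alphaD d * d) / √(lam γ δ) *
      conv (combE (lam γ δ / γ ^ 2 * (1 - γ ^ 2 * δ ^ 2 / (2 * lam γ δ)) ^ 2)
        (alphaD d * d * (1 - γ ^ 2 * δ ^ 2 / (2 * lam γ δ))) (j / d))
        (gauss (δ ^ 2 / lam γ δ)) q : ℝ) : ℂ) := by
  have hγ : γ ≠ 0 := by rintro rfl; simp at h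
  have hδ : δ ≠ 0 := by rintro rfl; simp at h
  have hl : 0 < lam γ δ := lam_pos γ δ
  have hd0 : (0 : ℝ) < d := by exact_mod_cast hd
  have hα := alphaD_pos hd
  have hw : 0 < √(δ ^ 2 / lam γ δ) := by positivity
  have hΓ : alphaD d * d * (1 - γ ^ 2 * δ ^ 2 / (2 * lam γ δ)) ≠ 0 := by positivity
  have hμ : 0 < lam γ δ / γ ^ 2 * (1 - γ ^ 2 * δ ^ 2 / (2 * lam γ δ)) ^ 2 := by positivity
  have hK := hasKetIntegral_integrand2 hd.ne' j h hρ
    ((summable_comb_packet hμ hΓ (√(δ ^ 2 / lam γ δ)) (j / d)).hasSum.const_smul _)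
  -- An `L²` vector is determined by its pairings with Schwartz functions, so the chosen weak
  -- integral is the packet series.
  rw [unnormalized2, hK.ketIntegral_eq]
  refine ⟨hK, (Lp.coeFn_smul _ _).trans ?_⟩
  filter_upwards [tsum_comb_packet_ae_eq hμ hΓ hw (j / d)] with q hq
  rw [Pi.smul_apply, hq, smul_eq_mul, ← Complex.ofReal_mul]
  congr 1
  rw [← mul_assoc, div_mul_cancel₀ _ (by positivity), Real.sq_sqrt (by positivity)]

theorem sqrt_mul_sqrt_div {A B C Γ : ℝ} (hA : 0 ≤ A) (hΓ : 0 < Γ) (h : A * B = C * Γ ^ 2) :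
    √A * (√B / Γ) = √C := by
  rw [← mul_div_assoc, ← Real.sqrt_mul hA, h, Real.sqrt_mul' _ (sq_nonneg Γ), Real.sqrt_sq hΓ.le,
    mul_div_cancel_right₀ _ hΓ.ne']

/-- Reduces each theta formula to four identities between parameters; the one for `K` says `√A
√(2πμ) / Γ = √K`. -/
theorem ofReal_mul_conv_eq_theta {μ ν Γ a q A K z t σ : ℝ} (hμ : 0 < μ) (hν : 0 < ν)
    (hΓ : 0 < Γ) (hA : 0 ≤ A) (hσ : μ + ν = σ) (hK : A * (2 * Real.pi * μ) = K * Γ ^ 2)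
    (hz : q * μ / (σ * Γ) = z) (ht : 2 * Real.pi * (μ * ν) / (σ * Γ ^ 2) = t) :
    ((√A * conv (combE μ Γ a) (gauss ν) q : ℝ) : ℂ) =
      ((√K * gauss σ q : ℝ) : ℂ) * theta 0 a ((-z : ℝ) : ℂ) (Complex.I * (t : ℂ)) := by
  rw [Complex.ofReal_mul, conv_eq_theta hμ hν hΓ, hσ, hz, ht, ← mul_assoc, ← Complex.ofReal_mul,
    ← mul_assoc, sqrt_mul_sqrt_div hA hΓ hK]

end GKP

theorem proposition1 (d j : ℕ) (hj : j < d) :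
    -- Approximation 1
    (∀ κ Δ : ℝ, 0 < κ → 0 < Δ →
      Summable (GKP.term1 d j κ Δ) ∧ 0 < GKP.N1 d j κ Δ ∧ ‖GKP.ket1 d j κ Δ‖ = 1 ∧
      (∀ᵐ q : ℝ, GKP.ket1 d j κ Δ q =
        ((√(2 * √(Real.pi * Δ ^ 2) / GKP.N1 d j κ Δ) *
          GKP.conv (GKP.combE (1 / κ ^ 2) (GKP.alphaD d * d) (j / d)) (GKP.gauss (Δ ^ 2)) q : ℝ) :
          ℂ)) ∧
      (∀ q : ℝ,
        ((√(2 * √(Real.pi * Δ ^ 2) / GKP.N1 d j κ Δ) *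
          GKP.conv (GKP.combE (1 / κ ^ 2) (GKP.alphaD d * d) (j / d)) (GKP.gauss (Δ ^ 2)) q : ℝ) :
          ℂ) =
        ((√(2 * √(Real.pi * Δ ^ 2) / (κ ^ 2 * d * GKP.N1 d j κ Δ)) *
          GKP.gauss ((1 + κ ^ 2 * Δ ^ 2) / κ ^ 2) q : ℝ) : ℂ) *
          GKP.theta 0 (j / d) ((-(q / (GKP.alphaD d * d * (1 + κ ^ 2 * Δ ^ 2))) : ℝ) : ℂ)
            (Complex.I * ((Δ ^ 2 / (d * (1 + κ ^ 2 * Δ ^ 2)) : ℝ) : ℂ)))) ∧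
    -- Approximation 2
    (∀ γ δ : ℝ, 0 < γ * δ → γ * δ < 2 →
      GKP.HasKetIntegral (GKP.integrand2 d j γ δ) (GKP.unnormalized2 d j γ δ) ∧
      0 < GKP.N2 d j γ δ ∧ ‖GKP.ket2 d j γ δ‖ = 1 ∧
      (∀ᵐ q : ℝ, GKP.ket2 d j γ δ q =
        ((√(GKP.alphaD d * d / (GKP.lam γ δ * GKP.N2 d j γ δ)) *
          GKP.conv
            (GKP.combE
              (GKP.lam γ δ / γ ^ 2 * (1 - γ ^ 2 * δ ^ 2 / (2 * GKP.lam γ δ)) ^ 2)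
              (GKP.alphaD d * d * (1 - γ ^ 2 * δ ^ 2 / (2 * GKP.lam γ δ)))
              (j / d))
            (GKP.gauss (δ ^ 2 / GKP.lam γ δ)) q : ℝ) : ℂ)) ∧
      (∀ q : ℝ,
        ((√(GKP.alphaD d * d / (GKP.lam γ δ * GKP.N2 d j γ δ)) *
          GKP.conv
            (GKP.combE
              (GKP.lam γ δ / γ ^ 2 * (1 - γ ^ 2 * δ ^ 2 / (2 * GKP.lam γ δ)) ^ 2)
              (GKP.alphaD d * d * (1 - γ ^ 2 * δ ^ 2 / (2 * GKP.lam γ δ)))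
              (j / d))
            (GKP.gauss (δ ^ 2 / GKP.lam γ δ)) q : ℝ) : ℂ) =
        ((√(GKP.alphaD d * (γ ^ 2)⁻¹ / GKP.N2 d j γ δ) *
          GKP.gauss (GKP.lam γ δ / γ ^ 2) q : ℝ) : ℂ) *
          GKP.theta 0 (j / d)
            ((-(q / (GKP.alphaD d * d) * (1 - γ ^ 2 * δ ^ 2 / (2 * GKP.lam γ δ))) : ℝ) : ℂ)
            (Complex.I * ((δ ^ 2 / (d * GKP.lam γ δ) : ℝ) : ℂ)))) ∧
    -- Approximation 3
    (∀ β : ℝ, 0 < β →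
      Summable (GKP.term3 d j β) ∧ 0 < GKP.N3 d j β ∧ ‖GKP.ket3 d j β‖ = 1 ∧
      (∀ᵐ q : ℝ, GKP.ket3 d j β q =
        ((√(GKP.alphaD d * d / (Real.cosh β * GKP.N3 d j β)) *
          GKP.conv
            (GKP.combE (1 / (Real.sinh β * Real.cosh β)) (GKP.alphaD d * d / Real.cosh β) (j / d))
            (GKP.gauss (Real.tanh β)) q : ℝ) : ℂ)) ∧
      (∀ q : ℝ,
        ((√(GKP.alphaD d * d / (Real.cosh β * GKP.N3 d j β)) *
          GKP.conv
            (GKP.combE (1 / (Real.sinh β * Real.cosh β)) (GKP.alphaD d * d / Real.cosh β) (j / d))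
            (GKP.gauss (Real.tanh β)) q : ℝ) : ℂ) =
        ((√(GKP.alphaD d / (Real.sinh β * GKP.N3 d j β)) *
          GKP.gauss (1 / Real.tanh β) q : ℝ) : ℂ) *
          GKP.theta 0 (j / d)
            ((-(q / (GKP.alphaD d * d * Real.cosh β)) : ℝ) : ℂ)
            (Complex.I * ((Real.tanh β / d : ℝ) : ℂ)))) := by
  have hd : 0 < d := by omega
  have hd0 : (0 : ℝ) < d := by exact_mod_cast hd
  have hα := GKP.alphaD_pos hd
  have hα2 := GKP.alphaD_sq_mul hd
  have hΓ : 0 < GKP.alphaD d * d := by positivity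
  -- This cancels `2π` in the theta parameter and leaves the factor `1/d`.
  have hΓ2 : (GKP.alphaD d * d) ^ 2 = 2 * Real.pi * d := by rw [← hα2]; ring
  refine ⟨fun κ Δ hκ hΔ => ?_, fun γ δ hpos hlt => ?_, fun β hβ => ?_⟩
  · obtain ⟨hsum, hae⟩ := GKP.approximation_comb hd j hκ hΔ
    have hμ : 0 < 1 / κ ^ 2 := by positivity
    have hν : 0 < Δ ^ 2 := by positivity
    obtain ⟨hN, hnorm, hket⟩ := GKP.normalize_of_ae_eq (by positivity)
      (GKP.conv_pos hμ hν hΓ.ne' (j / d)) hae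
    rw [Real.sq_sqrt (by positivity)] at hket
    refine ⟨hsum, hN, hnorm, hket, fun q => ?_⟩
    replace hN : 0 < GKP.N1 d j κ Δ := hN
    refine GKP.ofReal_mul_conv_eq_theta hμ hν hΓ (by positivity) (by field_simp) ?_ ?_ ?_
    · rw [hΓ2]
      field_simp
    · field_simp
    · rw [hΓ2]
      field_simp
  · have hγ : γ ≠ 0 := by rintro rfl; simp at hpos
    have hδ : δ ≠ 0 := by rintro rfl; simp at hpos
    have hl := GKP.lam_pos γ δ
    have hρ : 0 < 1 - γ ^ 2 * δ ^ 2 / (2 * GKP.lam γ δ) := by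
      -- Here `γ²δ² < 2λ` is equivalent to `γ²δ² < 4`, the place where `γδ < 2` enters.
      rw [sub_pos, div_lt_one (by positivity)]
      unfold GKP.lam
      nlinarith
    obtain ⟨hint, hae⟩ := GKP.approximation_displacement hd j hpos hρ
    set ρ := 1 - γ ^ 2 * δ ^ 2 / (2 * GKP.lam γ δ) with hρdef
    have hμ : 0 < GKP.lam γ δ / γ ^ 2 * ρ ^ 2 := by positivity
    have hν : 0 < δ ^ 2 / GKP.lam γ δ := by positivity
    have hΓ' : 0 < GKP.alphaD d * d * ρ := by positivity
    obtain ⟨hN, hnorm, hket⟩ := GKP.normalize_of_ae_eq (by positivity)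
      (GKP.conv_pos hμ hν hΓ'.ne' (j / d)) hae
    rw [div_pow, Real.sq_sqrt (by positivity), Real.sq_sqrt (by positivity), div_div] at hket
    refine ⟨hint, hN, hnorm, hket, fun q => ?_⟩
    replace hN : 0 < GKP.N2 d j γ δ := hN
    -- Equivalent to `1 - ρ² = γ²δ²/λ²`.
    have hadd : GKP.lam γ δ / γ ^ 2 * ρ ^ 2 + δ ^ 2 / GKP.lam γ δ = GKP.lam γ δ / γ ^ 2 := by
      rw [hρdef]
      unfold GKP.lam at hl ⊢
      field_simp
      ring
    refine GKP.ofReal_mul_conv_eq_theta hμ hν hΓ' (by positivity) hadd ?_ ?_ ?_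
    · rw [mul_pow, hΓ2]
      field_simp
    · field_simp
    · rw [mul_pow, hΓ2]
      field_simp
  · have hs : 0 < Real.sinh β := Real.sinh_pos_iff.2 hβ
    have hc : 0 < Real.cosh β := Real.cosh_pos β
    have hμ : 0 < 1 / (Real.sinh β * Real.cosh β) := by positivity
    have hν : 0 < Real.tanh β := by rw [Real.tanh_eq_sinh_div_cosh]; positivity
    have hΓ' : 0 < GKP.alphaD d * d / Real.cosh β := by positivity
    obtain ⟨hN, hnorm, hket⟩ := GKP.normalize_of_ae_eq (by positivity)
      (GKP.conv_pos hμ hν hΓ'.ne' (j / d)) (GKP.unnormalized3_ae_eq hd j hβ)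
    rw [div_pow, Real.sq_sqrt (by positivity), Real.sq_sqrt (by positivity), div_div] at hket
    refine ⟨GKP.summable_term3 hd j hβ, hN, hnorm, hket, fun q => ?_⟩
    replace hN : 0 < GKP.N3 d j β := hN
    have hadd : 1 / (Real.sinh β * Real.cosh β) + Real.tanh β = 1 / Real.tanh β := by
      rw [Real.tanh_eq_sinh_div_cosh]
      field_simp
      linear_combination -Real.cosh_sq β
    refine GKP.ofReal_mul_conv_eq_theta hμ hν hΓ' (by positivity) hadd ?_ ?_ ?_
    · rw [div_pow, hΓ2]
      field_simp
    · rw [Real.tanh_eq_sinh_div_cosh]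
      field_simp
    · rw [div_pow, hΓ2, Real.tanh_eq_sinh_div_cosh]
      field_simp
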